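/- Let $M$ be a connected, Hausdorff, second countable smooth manifold without boundary, and let $G$ be a connected Lie group acting on $M$. Let $K$ be a compact Lie group that contains $G$ as a dense Lie subgroup (that is, there is an injective smooth homomorphism $G\to K$ with dense image, through which $G$ is regarded as a subgroup of $K$), and suppose that the action of $G$ on $M$ is the restriction of a smooth action of $K$ on $M$. For $x\in M$ let $G_x\subset G$ be its isotropy subgroup, a closed subgroup of the Lie group $G$, and let $(G_x)_0$ be the identity component of $G_x$. The strata of $M$ are the classes of the equivalence relation $x\sim y\iff \dim G_x=\dim G_y$, and the regular stratum $R_{\mathcal F}$ is the open stratum, i.e. the set of the points whose stratum is open in $M$. Fix a base point $p\in R_{\mathcal F}$ and put $L=(G_p)_0$. Then for every $x\in R_{\mathcal F}$ there is $k\in K$ with $(G_x)_0=kLk^{-1}$. Moreover, $k$ can be chosen locally as a smooth function of $x$: every $x\in R_{\mathcal F}$ has an open neighborhood $V\subset R_{\mathcal F}$ and a smooth map $f\colon V\to K$ such that $(G_y)_0=f(y)\,L\,f(y)^{-1}$ for every $y\in V$. -/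

import Mathlib

open Set Topology
open scoped Manifold ContDiff

namespace KillingFoliation

/-- The identity component `S₀` of a subgroup `S` of a topological group `G`,
viewed again as a subgroup of `G`. -/
def identityComponent {G : Type*} [TopologicalSpace G] [Group G] [IsTopologicalGroup G]
    (S : Subgroup G) : Subgroup G :=
  (Subgroup.connectedComponentOfOne S).map S.subtype

/-- The conjugate subgroup `k S k⁻¹`. -/
def conjugate {K : Type*} [Group K] (k : K) (S : Subgroup K) : Subgroup K :=
  S.map (MulAut.conj k).toMonoidHom

section Dimension

variable (E : Type*) [NormedAddCommGroup E] [NormedSpace ℝ E]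
  {G : Type*} [TopologicalSpace G] [ChartedSpace E G] [Group G]

/-- The tangent space at the identity of a subgroup `S` of the Lie group `G` (modelled on `E`):
the subspace of `T₁G` spanned by the velocities at time `0` of the smooth curves of `G` that
take their values in `S` and pass through `1` at time `0`. For a closed subgroup `S` the set of
these velocities is already a subspace, namely the Lie algebra of the Lie group `S`. -/
noncomputable def tangentAtOne (S : Subgroup G) : Submodule ℝ (GroupLieAlgebra 𝓘(ℝ, E) G) :=
  Submodule.span ℝ {v | ∃ γ : ℝ → G, ContMDiff 𝓘(ℝ, ℝ) 𝓘(ℝ, E) ∞ γ ∧ (∀ t, γ t ∈ S) ∧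
    γ 0 = 1 ∧ v = mfderiv 𝓘(ℝ, ℝ) 𝓘(ℝ, E) γ 0 (1 : ℝ)}

/-- The dimension of a closed subgroup `S` of the Lie group `G`. -/
noncomputable def subgroupDim (S : Subgroup G) : ℕ :=
  Module.finrank ℝ (tangentAtOne E S)

variable (G) {M : Type*} [MulAction G M]

/-- The stratum through `x`: the class of `x` for the relation
`x ∼ y ↔ dim G_x = dim G_y`. -/
def stratum (x : M) : Set M :=
  {y | subgroupDim E (MulAction.stabilizer G x) = subgroupDim E (MulAction.stabilizer G y)}

variable (M) in
/-- The regular stratum `R_𝓕`, that is, the open stratum: the points whose stratum is open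
in `M`. -/
def regularStratum [TopologicalSpace M] : Set M :=
  {x | IsOpen (stratum E G x)}

end Dimension

end KillingFoliation

/-!
Near a point `x`, averaging a chart over the compact group `K_x` linearizes its action, and a
`K_x`-invariant complement of the tangent space of the orbit `K x` gives a linear slice: nearby
points are of the form `c(y) • n` with `c` smooth, `n` in the slice and `K_n ⊆ K_x`. Hence
`dim G_y ≤ dim G_x` near `x`, so that the regular points are dense, and `c(y)` conjugates `(G_x)₀`
to `(G_y)₀` when `x` is regular. Here density enters: `ι(G)` is normal in `K`, so conjugation by an
element of `K` restricts to a diffeomorphism of `G` and preserves dimensions of isotropy groups.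

To compare two regular points `v` and `w` of one linear slice, move `w` inside its `K_x`-orbit to a
point nearest to `v`. An element fixing a point inside the segment from `v` to `w` then fixes both
ends, so the isotropy group is `G_v ∩ G_w` all along the interior of the segment, and regularity of
the ends forces `(G_v)₀ = (G_v ∩ G_w)₀ = (G_w)₀`. Connectedness of `M` and density of the regular
points chain these local comparisons together.
-/

namespace KillingFoliation

open Filter MeasureTheory

section SmoothNear

variable {E F F' : Type*} [NormedAddCommGroup E] [NormedSpace ℝ E]
  [NormedAddCommGroup F] [NormedSpace ℝ F] [NormedAddCommGroup F'] [NormedSpace ℝ F']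
  {X Y Z : Type*} [TopologicalSpace X] [ChartedSpace E X] [TopologicalSpace Y] [ChartedSpace F Y]
  [TopologicalSpace Z] [ChartedSpace F' Z]

variable (E F) in
/-- The map `f` between manifolds modelled on `E` and `F` is smooth on a neighbourhood of `x`. -/
def SmoothNear (f : X → Y) (x : X) : Prop :=
  ∀ᶠ y in 𝓝 x, ContMDiffAt 𝓘(ℝ, E) 𝓘(ℝ, F) ∞ f y

theorem smoothNear_iff_contDiffAt {f : E → F} {x : E} :
    SmoothNear E F f x ↔ ∀ᶠ y in 𝓝 x, ContDiffAt ℝ ∞ f y := by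
  simp only [SmoothNear, contMDiffAt_iff_contDiffAt]

theorem smoothNear_of_contMDiff {f : X → Y} (hf : ContMDiff 𝓘(ℝ, E) 𝓘(ℝ, F) ∞ f) (x : X) :
    SmoothNear E F f x :=
  Eventually.of_forall fun y ↦ hf y

theorem smoothNear_const (y : Y) (x : X) : SmoothNear E F (fun _ : X ↦ y) x :=
  smoothNear_of_contMDiff contMDiff_const x

theorem smoothNear_id (x : X) : SmoothNear E E (fun y : X ↦ y) x :=
  smoothNear_of_contMDiff contMDiff_id x

namespace SmoothNear

variable {f : X → Y} {g : Y → Z} {x : X}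

theorem contMDiffAt (hf : SmoothNear E F f x) : ContMDiffAt 𝓘(ℝ, E) 𝓘(ℝ, F) ∞ f x :=
  hf.self_of_nhds

theorem continuousAt (hf : SmoothNear E F f x) : ContinuousAt f x :=
  hf.contMDiffAt.continuousAt

theorem tendsto (hf : SmoothNear E F f x) {y : Y} (hy : f x = y) : Tendsto f (𝓝 x) (𝓝 y) :=
  hy ▸ hf.continuousAt

theorem mdifferentiableAt (hf : SmoothNear E F f x) :
    MDifferentiableAt 𝓘(ℝ, E) 𝓘(ℝ, F) f x :=
  hf.contMDiffAt.mdifferentiableAt (by simp)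

theorem eventually (hf : SmoothNear E F f x) : ∀ᶠ y in 𝓝 x, SmoothNear E F f y :=
  eventually_eventually_nhds.2 hf

theorem comp (hg : SmoothNear F F' g (f x)) (hf : SmoothNear E F f x) :
    SmoothNear E F' (fun z ↦ g (f z)) x := by
  filter_upwards [hf, hf.continuousAt.eventually hg] with y hfy hgy
  exact ContMDiffAt.comp y hgy hfy

theorem comp_of_eq {y : Y} (hg : SmoothNear F F' g y) (hf : SmoothNear E F f x) (h : f x = y) :
    SmoothNear E F' (fun z ↦ g (f z)) x := by
  subst h
  exact hg.comp hf

theorem congr {f' : X → Y} (hf : SmoothNear E F f x) (h : f' =ᶠ[𝓝 x] f) :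
    SmoothNear E F f' x := by
  filter_upwards [hf, h.eventually_nhds] with y hfy hy using hfy.congr_of_eventuallyEq hy

theorem smul {A : Type*} [TopologicalSpace A] [ChartedSpace F' A] [Group A] [MulAction A Y]
    [ContMDiffSMul 𝓘(ℝ, F') 𝓘(ℝ, F) ∞ A Y] {a : X → A}
    (ha : SmoothNear E F' a x) (hf : SmoothNear E F f x) :
    SmoothNear E F (fun y ↦ a y • f y) x := by
  filter_upwards [ha, hf] with y hay hfy
  exact ContMDiffAt.smul (I := 𝓘(ℝ, F')) (I' := 𝓘(ℝ, F)) hay hfy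

variable [Group Y] [LieGroup 𝓘(ℝ, F) ∞ Y]

theorem mul {f' : X → Y} (hf : SmoothNear E F f x) (hf' : SmoothNear E F f' x) :
    SmoothNear E F (fun y ↦ f y * f' y) x := by
  filter_upwards [hf, hf'] with y hfy hfy' using ContMDiffAt.mul hfy hfy'

theorem inv (hf : SmoothNear E F f x) : SmoothNear E F (fun y ↦ (f y)⁻¹) x := by
  filter_upwards [hf] with y hfy using ContMDiffAt.inv hfy

end SmoothNear

variable (E F) in
/-- The derivative of a map between manifolds modelled on `E` and `F`, where the tangent spaces
are identified with the model spaces by means of the preferred charts. -/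
noncomputable def mderiv (f : X → Y) (x : X) : E →L[ℝ] F :=
  mfderiv 𝓘(ℝ, E) 𝓘(ℝ, F) f x

theorem mderiv_eq_fderiv (f : E → F) (x : E) : mderiv E F f x = fderiv ℝ f x :=
  mfderiv_eq_fderiv

theorem mderiv_id (x : X) : mderiv E E (fun y : X ↦ y) x = .id ℝ E :=
  mfderiv_id

theorem mderiv_const (y : Y) (x : X) : mderiv E F (fun _ : X ↦ y) x = 0 :=
  mfderiv_const

theorem mderiv_congr {f f' : X → Y} {x : X} (h : f =ᶠ[𝓝 x] f') :
    mderiv E F f x = mderiv E F f' x :=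
  h.mfderiv_eq

theorem mderiv_comp {f : X → Y} {g : Y → Z} {x : X} {y : Y} (hg : SmoothNear F F' g y)
    (hf : SmoothNear E F f x) (h : f x = y) :
    mderiv E F' (fun z ↦ g (f z)) x = (mderiv F F' g y).comp (mderiv E F f x) := by
  subst h
  exact mfderiv_comp x hg.mdifferentiableAt hf.mdifferentiableAt

theorem smoothNear_fst (z : E × F) : SmoothNear (E × F) E (fun z : E × F ↦ z.1) z :=
  smoothNear_of_contMDiff contDiff_fst.contMDiff z

theorem smoothNear_snd (z : E × F) : SmoothNear (E × F) F (fun z : E × F ↦ z.2) z :=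
  smoothNear_of_contMDiff contDiff_snd.contMDiff z

theorem mderiv_prod_apply {f : E × F → Z} {z : E × F} (hf : SmoothNear (E × F) F' f z)
    (v : E × F) : mderiv (E × F) F' f z v =
      mderiv E F' (fun a ↦ f (a, z.2)) z.1 v.1 + mderiv F F' (fun b ↦ f (z.1, b)) z.2 v.2 := by
  have hl : HasFDerivAt (fun a : E ↦ (a, z.2)) (.inl ℝ E F) z.1 := hasFDerivAt_prodMk_left _ _
  have hr : HasFDerivAt (fun b : F ↦ (z.1, b)) (.inr ℝ E F) z.2 := hasFDerivAt_prodMk_right _ _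
  have hls : SmoothNear E (E × F) (fun a : E ↦ (a, z.2)) z.1 :=
    smoothNear_of_contMDiff (contDiff_id.prodMk contDiff_const).contMDiff _
  have hrs : SmoothNear F (E × F) (fun b : F ↦ (z.1, b)) z.2 :=
    smoothNear_of_contMDiff (contDiff_const.prodMk contDiff_id).contMDiff _
  rw [mderiv_comp hf hls rfl, mderiv_comp hf hrs rfl, mderiv_eq_fderiv, mderiv_eq_fderiv,
    hl.fderiv, hr.fderiv, ContinuousLinearMap.comp_apply, ContinuousLinearMap.comp_apply,
    ← map_add]
  simp

end SmoothNear

section InverseFunction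

variable {E F : Type*} [NormedAddCommGroup E] [NormedSpace ℝ E]
  [NormedAddCommGroup F] [NormedSpace ℝ F]

theorem eventually_isInvertible_fderiv [CompleteSpace E] {f : E → F} {a : E}
    (hf : ContDiffAt ℝ ∞ f a) (hf' : (fderiv ℝ f a).IsInvertible) :
    ∀ᶠ x in 𝓝 a, (fderiv ℝ f x).IsInvertible := by
  obtain ⟨e, he⟩ := hf'
  have hcont : ContinuousAt (fderiv ℝ f) a :=
    (hf.fderiv_right (m := 0) (by simp)).continuousAt
  exact hcont (he ▸ e.nhds)

theorem exists_smooth_local_inverse_of_isInvertible_fderiv [CompleteSpace E] {f : E → F} {a : E}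
    (hf : SmoothNear E F f a) (hf' : (fderiv ℝ f a).IsInvertible) :
    ∃ g : F → E, g (f a) = a ∧ SmoothNear F E g (f a) ∧
      (∀ᶠ x in 𝓝 a, g (f x) = x) ∧ ∀ᶠ y in 𝓝 (f a), f (g y) = y := by
  have hne : (∞ : WithTop ℕ∞) ≠ 0 := by simp
  simp only [smoothNear_iff_contDiffAt] at hf ⊢
  have hfa : ContDiffAt ℝ ∞ f a := hf.self_of_nhds
  have hinv := eventually_isInvertible_fderiv hfa hf'
  obtain ⟨f', hf'⟩ := hf'
  have hderiv : HasFDerivAt f (f' : E →L[ℝ] F) a :=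
    hf' ▸ (hfa.differentiableAt hne).hasFDerivAt
  set e := hfa.toOpenPartialHomeomorph f hderiv hne
  have hef : ⇑e = f := hfa.toOpenPartialHomeomorph_coe hderiv hne
  have ha : a ∈ e.source := hfa.mem_toOpenPartialHomeomorph_source hderiv hne
  have hfa' : f a ∈ e.target := hef ▸ e.map_source ha
  have hleft : ∀ x ∈ e.source, e.symm (f x) = x := fun x hx ↦ hef ▸ e.left_inv hx
  have hcont : Tendsto e.symm (𝓝 (f a)) (𝓝 a) := by
    simpa only [ContinuousAt, hleft a ha] using e.continuousAt_symm hfa'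
  refine ⟨e.symm, hleft a ha, ?_, eventually_of_mem (e.open_source.mem_nhds ha) hleft, ?_⟩
  · filter_upwards [hcont.eventually hf, hcont.eventually hinv, e.open_target.mem_nhds hfa']
      with y hfy ⟨f₁, hf₁⟩ hy
    refine e.contDiffAt_symm (f₀' := f₁) hy ?_ (by rwa [hef])
    rw [hef, hf₁]
    exact (hfy.differentiableAt hne).hasFDerivAt
  · filter_upwards [e.open_target.mem_nhds hfa'] with y hy
    rw [← hef, e.right_inv hy]

theorem mderiv_comp_mderiv_eq_id {X Y : Type*} [TopologicalSpace X] [ChartedSpace E X]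
    [TopologicalSpace Y] [ChartedSpace F Y] {f : X → Y} {g : Y → X} {x : X} {y : Y}
    (hg : SmoothNear F E g y) (hf : SmoothNear E F f x) (hxy : f x = y)
    (hgf : ∀ᶠ z in 𝓝 x, g (f z) = z) :
    (mderiv F E g y).comp (mderiv E F f x) = .id ℝ E := by
  rw [← mderiv_comp hg hf hxy, ← mderiv_id (E := E) x]
  exact mderiv_congr hgf

variable {X Y : Type*} [TopologicalSpace X] [ChartedSpace E X] [IsManifold 𝓘(ℝ, E) ∞ X]
  [TopologicalSpace Y] [ChartedSpace F Y]

theorem mderiv_extChartAt_self (x : X) : mderiv E E (extChartAt 𝓘(ℝ, E) x) x = .id ℝ E := by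
  have : IsManifold 𝓘(ℝ, E) 1 X := .of_le (n := ∞) (by simp)
  refine (mfderiv_chartAt_eq_tangentCoordChange (mem_chart_source E x)).trans ?_
  ext v
  exact tangentCoordChange_self (mem_extChartAt_source x)

variable (E) in
theorem exists_centered_chart (x : X) : ∃ (φ : E → X) (ψ : X → E), SmoothNear E E φ 0 ∧
    SmoothNear E E ψ x ∧ φ 0 = x ∧ ψ x = 0 ∧ mderiv E E φ 0 = .id ℝ E ∧
    mderiv E E ψ x = .id ℝ E ∧
    (∀ᶠ v in 𝓝 0, ψ (φ v) = v) ∧ ∀ᶠ y in 𝓝 x, φ (ψ y) = y := by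
  set e := extChartAt 𝓘(ℝ, E) x
  have hadd : SmoothNear E E (fun v ↦ e x + v) 0 :=
    smoothNear_of_contMDiff (contDiff_const.add contDiff_id).contMDiff 0
  have hsub : SmoothNear E E (fun v ↦ v - e x) (e x) :=
    smoothNear_of_contMDiff (contDiff_id.sub contDiff_const).contMDiff _
  have he : SmoothNear E E e x := by
    filter_upwards [(isOpen_extChartAt_source (I := 𝓘(ℝ, E)) x).mem_nhds
      (mem_extChartAt_source x)] with y hy
    exact contMDiffAt_extChartAt' (by simpa using hy)
  have hsymm : SmoothNear E E e.symm (e x) := by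
    filter_upwards [(isOpen_extChartAt_target x).mem_nhds (mem_extChartAt_target x)] with v hv
    exact (contMDiffOn_extChartAt_symm x).contMDiffAt ((isOpen_extChartAt_target x).mem_nhds hv)
  have hφ : SmoothNear E E (fun v ↦ e.symm (e x + v)) 0 := hsymm.comp_of_eq hadd (add_zero _)
  have hψ : SmoothNear E E (fun y ↦ e y - e x) x := hsub.comp he
  have hψφ : ∀ᶠ v in 𝓝 (0 : E), e (e.symm (e x + v)) - e x = v := by
    filter_upwards [hadd.tendsto (add_zero _)
      ((isOpen_extChartAt_target x).mem_nhds (mem_extChartAt_target x))] with v hv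
    rw [e.right_inv hv, add_sub_cancel_left]
  have hφψ : ∀ᶠ y in 𝓝 x, e.symm (e x + (e y - e x)) = y := by
    filter_upwards [(isOpen_extChartAt_source (I := 𝓘(ℝ, E)) x).mem_nhds
      (mem_extChartAt_source x)] with y hy
    rw [add_sub_cancel, e.left_inv hy]
  have hx : e.symm (e x + 0) = x := by rw [add_zero, extChartAt_to_inv]
  have hψ' : mderiv E E (fun y ↦ e y - e x) x = .id ℝ E := by
    rw [mderiv_comp hsub he rfl, mderiv_extChartAt_self, mderiv_eq_fderiv, fderiv_sub_const,
      fderiv_fun_id, ContinuousLinearMap.id_comp]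
  refine ⟨_, _, hφ, hψ, hx, sub_self _, ?_, hψ', hψφ, hφψ⟩
  rw [← mderiv_comp_mderiv_eq_id hψ hφ hx hψφ, hψ', ContinuousLinearMap.id_comp]

variable [IsManifold 𝓘(ℝ, F) ∞ Y]

theorem exists_smooth_local_inverse [CompleteSpace E] {f : X → Y} {x : X}
    (hf : SmoothNear E F f x) (hf' : (mderiv E F f x).IsInvertible) :
    ∃ g : Y → X, g (f x) = x ∧ SmoothNear F E g (f x) ∧
      (∀ᶠ z in 𝓝 x, g (f z) = z) ∧ ∀ᶠ y in 𝓝 (f x), f (g y) = y := by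
  obtain ⟨φ, φ', hφ, hφ', hφ0, hφ'x, hDφ, -, -, hφφ'⟩ := exists_centered_chart E x
  obtain ⟨ψ, ψ', -, hψ', -, hψ'y, -, hDψ', -, hψψ'⟩ := exists_centered_chart F (f x)
  have hfφ : SmoothNear E F (fun v ↦ f (φ v)) 0 := hf.comp_of_eq hφ hφ0
  have hfφ0 : f (φ 0) = f x := congrArg f hφ0
  have hk : SmoothNear E F (fun v ↦ ψ' (f (φ v))) 0 := hψ'.comp_of_eq hfφ hfφ0
  have hk' : fderiv ℝ (fun v ↦ ψ' (f (φ v))) 0 = mderiv E F f x := by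
    rw [← mderiv_eq_fderiv, mderiv_comp hψ' hfφ hfφ0, mderiv_comp hf hφ hφ0, hDφ, hDψ',
      ContinuousLinearMap.id_comp, ContinuousLinearMap.comp_id]
  have hk0 : ψ' (f (φ 0)) = 0 := by rw [hφ0, hψ'y]
  obtain ⟨g, hg0, hg, hgk, hkg⟩ :=
    exists_smooth_local_inverse_of_isInvertible_fderiv hk (hk' ▸ hf')
  rw [hk0] at hg0 hg hkg
  have hgψ' : SmoothNear F E (fun y ↦ g (ψ' y)) (f x) := hg.comp_of_eq hψ' hψ'y
  have hgψ'0 : g (ψ' (f x)) = 0 := by rw [hψ'y, hg0]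
  refine ⟨fun y ↦ φ (g (ψ' y)), by simp only [hgψ'0, hφ0], hφ.comp_of_eq hgψ' hgψ'0, ?_, ?_⟩
  · filter_upwards [hφφ', (hφ'.tendsto hφ'x).eventually hgk] with z hz hgz
    rw [hz] at hgz
    rw [hgz, hz]
  · have hcont : Tendsto (fun y ↦ f (φ (g (ψ' y)))) (𝓝 (f x)) (𝓝 (f x)) :=
      (hfφ.tendsto hfφ0).comp (hgψ'.tendsto hgψ'0)
    filter_upwards [hcont.eventually hψψ', hψψ', (hψ'.tendsto hψ'y).eventually hkg]
      with y h₁ h₂ h₃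
    rw [← h₁, h₃, h₂]

theorem eventually_eq_of_fderiv_eq_zero {f : E → F} {a : E}
    (hf : ∀ᶠ x in 𝓝 a, HasFDerivAt f (0 : E →L[ℝ] F) x) : ∀ᶠ x in 𝓝 a, f x = f a := by
  obtain ⟨r, hr, hball⟩ := Metric.eventually_nhds_iff_ball.1 hf
  filter_upwards [Metric.ball_mem_nhds a hr] with x hx
  refine (convex_ball a r).is_const_of_fderivWithin_eq_zero (𝕜 := ℝ)
    (fun y hy ↦ (hball y hy).differentiableAt.differentiableWithinAt) (fun y hy ↦ ?_)
    hx (Metric.mem_ball_self hr)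
  rw [fderivWithin_of_isOpen Metric.isOpen_ball hy, (hball y hy).fderiv]

theorem eventually_eq_of_mderiv_eq_zero {f : X → Y} {x : X} (hf : SmoothNear E F f x)
    (hf' : ∀ᶠ z in 𝓝 x, mderiv E F f z = 0) : ∀ᶠ z in 𝓝 x, f z = f x := by
  obtain ⟨φ, φ', hφ, hφ', hφ0, hφ'x, -, -, -, hφφ'⟩ := exists_centered_chart E x
  obtain ⟨ψ, ψ', -, hψ', -, -, -, -, -, hψψ'⟩ := exists_centered_chart F (f x)
  have hfφ : SmoothNear E F (fun v ↦ f (φ v)) 0 := hf.comp_of_eq hφ hφ0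
  have hfφ0 : f (φ 0) = f x := congrArg f hφ0
  have hconst : ∀ᶠ v in 𝓝 0, ψ' (f (φ v)) = ψ' (f (φ 0)) := by
    refine eventually_eq_of_fderiv_eq_zero ?_
    filter_upwards [(hfφ.tendsto hfφ0).eventually hψ'.eventually, hφ.eventually,
      (hφ.tendsto hφ0).eventually hf.eventually, (hφ.tendsto hφ0).eventually hf']
      with v hψ'v hφv hfv hfv'
    have hfφv : SmoothNear E F (fun v ↦ f (φ v)) v := hfv.comp hφv
    have hzero : fderiv ℝ (fun v ↦ ψ' (f (φ v))) v = 0 := by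
      rw [← mderiv_eq_fderiv, mderiv_comp hψ'v hfφv rfl, mderiv_comp hfv hφv rfl, hfv',
        ContinuousLinearMap.zero_comp, ContinuousLinearMap.comp_zero]
    exact hzero ▸ (mdifferentiableAt_iff_differentiableAt.1
      (SmoothNear.comp (f := fun w ↦ f (φ w)) hψ'v hfφv).mdifferentiableAt).hasFDerivAt
  filter_upwards [hφφ', (hφ'.tendsto hφ'x).eventually hconst, hf.continuousAt.eventually hψψ']
    with z hz hcz hfz
  rw [hz, hφ0] at hcz
  rw [← hfz, hcz, hψψ'.self_of_nhds]

end InverseFunction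

section InfinitesimalAction

variable {E EA EM : Type*} [NormedAddCommGroup E] [NormedSpace ℝ E]
  [NormedAddCommGroup EA] [NormedSpace ℝ EA] [NormedAddCommGroup EM] [NormedSpace ℝ EM]
  {X : Type*} [TopologicalSpace X] [ChartedSpace E X]
  {A : Type*} [TopologicalSpace A] [ChartedSpace EA A] [Group A]
  {M : Type*} [TopologicalSpace M] [ChartedSpace EM M] [MulAction A M]

variable (EA EM A) in
/-- The infinitesimal action of the Lie group `A` at the point `y` of the manifold `M`: the
derivative at `1` of the orbit map of `y`. Its range is the tangent space of the orbit of `y`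
and its kernel is the Lie algebra of the isotropy subgroup of `y`. -/
noncomputable def infAction (y : M) : EA →L[ℝ] EM :=
  mderiv EA EM (fun a : A ↦ a • y) 1

variable (EA) in
/-- The adjoint representation of the Lie group `A`. -/
noncomputable def Ad (k : A) : EA →L[ℝ] EA :=
  mderiv EA EA (fun a : A ↦ k * a * k⁻¹) 1

section Adjoint

theorem Ad_one : Ad EA (1 : A) = .id ℝ EA := by
  simpa only [Ad, one_mul, inv_one, mul_one] using mderiv_id (E := EA) (1 : A)

variable [LieGroup 𝓘(ℝ, EA) ∞ A]

theorem smoothNear_mul_mul (k l a : A) : SmoothNear EA EA (fun b : A ↦ k * b * l) a :=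
  ((smoothNear_const k a).mul (smoothNear_id a)).mul (smoothNear_const l a)

theorem Ad_mul (k l : A) : Ad EA (k * l) = (Ad EA k).comp (Ad EA l) := by
  simp only [Ad]
  rw [← mderiv_comp (smoothNear_mul_mul k k⁻¹ 1) (smoothNear_mul_mul l l⁻¹ 1) (by group)]
  simp only [mul_inv_rev, mul_assoc]

theorem Ad_comp_Ad_inv (k : A) : (Ad EA k).comp (Ad EA k⁻¹) = .id ℝ EA := by
  rw [← Ad_mul, mul_inv_cancel, Ad_one]

theorem Ad_inv_comp_Ad (k : A) : (Ad EA k⁻¹).comp (Ad EA k) = .id ℝ EA := by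
  rw [← Ad_mul, inv_mul_cancel, Ad_one]

end Adjoint

variable [ContMDiffSMul 𝓘(ℝ, EA) 𝓘(ℝ, EM) ∞ A M]

variable (EA) in
include EA in
theorem smoothNear_const_smul (a : A) (y : M) : SmoothNear EM EM (fun z : M ↦ a • z) y :=
  SmoothNear.smul (F' := EA) (smoothNear_const a y) (smoothNear_id y)

theorem smoothNear_smul_const (y : M) (a : A) : SmoothNear EA EM (fun b : A ↦ b • y) a :=
  (smoothNear_id a).smul (smoothNear_const y a)

variable [LieGroup 𝓘(ℝ, EA) ∞ A]

theorem mderiv_smul_const {θ : X → A} {p : X} (hθ : SmoothNear E EA θ p) (y : M) :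
    mderiv E EM (fun q ↦ θ q • y) p =
      (infAction EA EM A (θ p • y)).comp (mderiv E EA (fun q ↦ θ q * (θ p)⁻¹) p) := by
  rw [infAction, ← mderiv_comp (smoothNear_smul_const _ 1)
    (hθ.mul (smoothNear_const (θ p)⁻¹ p)) (mul_inv_cancel _)]
  simp only [smul_smul, inv_mul_cancel_right]

theorem range_mderiv_smul_const_le {θ : X → A} {p : X} (hθ : SmoothNear E EA θ p) (y : M) :
    (mderiv E EM (fun q ↦ θ q • y) p).range ≤ (infAction EA EM A (θ p • y)).range := by
  rw [mderiv_smul_const hθ]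
  exact LinearMap.range_comp_le_range _ _

theorem infAction_smul (k : A) (y : M) :
    infAction EA EM A (k • y) =
      (mderiv EM EM (fun z : M ↦ k • z) y).comp ((infAction EA EM A y).comp (Ad EA k⁻¹)) := by
  have hconj : SmoothNear EA EA (fun a : A ↦ k⁻¹ * a * k⁻¹⁻¹) 1 := smoothNear_mul_mul _ _ _
  have h1 : k⁻¹ * 1 * k⁻¹⁻¹ = 1 := by group
  have horb : SmoothNear EA EM (fun a : A ↦ (k⁻¹ * a * k⁻¹⁻¹) • y) 1 :=
    hconj.smul (smoothNear_const y 1)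
  rw [infAction, infAction, Ad, ← mderiv_comp (smoothNear_smul_const y 1) hconj h1,
    ← mderiv_comp (smoothNear_const_smul EA k y) horb (by rw [h1, one_smul])]
  simp only [smul_smul, inv_inv, mul_assoc, mul_inv_cancel_left]

theorem infAction_smul_comp_Ad (k : A) (y : M) :
    (infAction EA EM A (k • y)).comp (Ad EA k) =
      (mderiv EM EM (fun z : M ↦ k • z) y).comp (infAction EA EM A y) := by
  rw [infAction_smul, ContinuousLinearMap.comp_assoc, ContinuousLinearMap.comp_assoc,
    Ad_inv_comp_Ad, ContinuousLinearMap.comp_id]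

theorem infAction_eq_zero_iff_Ad (k : A) (y : M) (v : EA) :
    infAction EA EM A (k • y) (Ad EA k v) = 0 ↔ infAction EA EM A y v = 0 := by
  have himp : ∀ (l : A) (z : M) (w : EA), infAction EA EM A z w = 0 →
      infAction EA EM A (l • z) (Ad EA l w) = 0 := fun l z w hw ↦ by
    rw [← ContinuousLinearMap.comp_apply, infAction_smul_comp_Ad,
      ContinuousLinearMap.comp_apply, hw, map_zero]
  refine ⟨fun h ↦ ?_, himp k y v⟩
  simpa only [inv_smul_smul, ← ContinuousLinearMap.comp_apply, Ad_inv_comp_Ad,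
    ContinuousLinearMap.id_apply] using himp k⁻¹ _ _ h

theorem finrank_range_infAction_smul [FiniteDimensional ℝ EA] (k : A) (y : M) :
    Module.finrank ℝ (infAction EA EM A (k • y)).range =
      Module.finrank ℝ (infAction EA EM A y).range := by
  have hle : ∀ (l : A) (z : M), Module.finrank ℝ (infAction EA EM A (l • z)).range ≤
      Module.finrank ℝ (infAction EA EM A z).range := fun l z ↦ by
    refine le_trans ?_ (Submodule.finrank_map_le
      (mderiv EM EM (fun w : M ↦ l • w) z).toLinearMap (infAction EA EM A z).range)
    refine Submodule.finrank_mono ?_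
    rintro _ ⟨v, rfl⟩
    exact ⟨_, ⟨Ad EA l⁻¹ v, rfl⟩, by rw [infAction_smul]; rfl⟩
  have hge := hle k⁻¹ (k • y)
  rw [inv_smul_smul] at hge
  exact (hle k y).antisymm hge

end InfinitesimalAction

section Continuity

variable {E E' F : Type*} [NormedAddCommGroup E] [NormedSpace ℝ E]
  [NormedAddCommGroup E'] [NormedSpace ℝ E'] [NormedAddCommGroup F] [NormedSpace ℝ F]
  {P : Type*} [TopologicalSpace P] [ChartedSpace E' P] [IsManifold 𝓘(ℝ, E') ∞ P]
  {X Y : Type*} [TopologicalSpace X] [ChartedSpace E X] [IsManifold 𝓘(ℝ, E) ∞ X]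
  [TopologicalSpace Y] [ChartedSpace F Y] [IsManifold 𝓘(ℝ, F) ∞ Y]

theorem inTangentCoordinates_of_apply_eq {T : Type*} (φ : T → E →L[ℝ] F) (x : X) {g : T → Y}
    {p q : T} (hq : g q = g p) :
    inTangentCoordinates 𝓘(ℝ, E) 𝓘(ℝ, F) (fun _ ↦ x) g φ p q = φ q := by
  rw [inTangentCoordinates_eq _ _ _ (mem_chart_source E x) (hq ▸ mem_chart_source F _)]
  ext v
  rw [hq]
  exact ((tangentBundleCore 𝓘(ℝ, F) Y).coordChange_self _ _ (mem_chart_source F _) _).trans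
    (congrArg (φ q) ((tangentBundleCore 𝓘(ℝ, E) X).coordChange_self _ _ (mem_chart_source E x) v))

theorem continuousOn_mderiv_of_apply_eq {f : P → X → Y}
    (hf : ContMDiff (𝓘(ℝ, E').prod 𝓘(ℝ, E)) 𝓘(ℝ, F) ∞ (Function.uncurry f)) (x : X) (y : Y) :
    ContinuousOn (fun p ↦ mderiv E F (f p) x) {p | f p x = y} := by
  have : IsManifold 𝓘(ℝ, E) 1 X := .of_le (n := ∞) (by simp)
  have : IsManifold 𝓘(ℝ, F) 1 Y := .of_le (n := ∞) (by simp)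
  intro p hp
  have hcont := (ContMDiffAt.mfderiv (m := 0) f (fun _ ↦ x) hf.contMDiffAt
    (contMDiffAt_const (x := p)) (by simp)).continuousAt.continuousWithinAt (s := {p | f p x = y})
  refine hcont.congr_of_eventuallyEq_of_mem ?_ hp
  filter_upwards [self_mem_nhdsWithin] with q hq
  have hqp : f q x = f p x := hq.trans hp.symm
  exact (inTangentCoordinates_of_apply_eq (fun q ↦ mderiv E F (f q) x) x hqp).symm

theorem continuous_Ad {A : Type*} [TopologicalSpace A] [ChartedSpace E A] [Group A]
    [LieGroup 𝓘(ℝ, E) ∞ A] : Continuous (Ad E : A → E →L[ℝ] E) := by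
  have hconj : ContMDiff (𝓘(ℝ, E).prod 𝓘(ℝ, E)) 𝓘(ℝ, E) ∞
      (Function.uncurry fun k a : A ↦ k * a * k⁻¹) :=
    (contMDiff_fst.mul contMDiff_snd).mul contMDiff_fst.inv
  rw [← continuousOn_univ]
  exact (continuousOn_mderiv_of_apply_eq hconj 1 1).mono fun k _ ↦
    show k * 1 * k⁻¹ = 1 by rw [mul_one, mul_inv_cancel]

end Continuity

theorem comp_eq_zero_of_finrank_range_le {𝕜 V W Z U : Type*} [Field 𝕜] [AddCommGroup V] [Module 𝕜 V]
    [FiniteDimensional 𝕜 V] [AddCommGroup W] [Module 𝕜 W] [AddCommGroup Z] [Module 𝕜 Z]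
    [AddCommGroup U] [Module 𝕜 U] {T : V →ₗ[𝕜] W} {J : U →ₗ[𝕜] V} {S : W →ₗ[𝕜] Z}
    (hinj : Function.Injective (T ∘ₗ J))
    (hrank : Module.finrank 𝕜 T.range ≤ Module.finrank 𝕜 U) (h : S ∘ₗ T ∘ₗ J = 0) :
    S ∘ₗ T = 0 := by
  have hle : (T ∘ₗ J).range ≤ T.range := LinearMap.range_comp_le_range J T
  have hrange : (T ∘ₗ J).range = T.range :=
    Submodule.eq_of_le_of_finrank_le hle (by rwa [LinearMap.finrank_range_of_inj hinj])
  ext v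
  obtain ⟨w, hw⟩ : T v ∈ (T ∘ₗ J).range := hrange ▸ LinearMap.mem_range_self T v
  rw [LinearMap.comp_apply, ← hw]
  exact LinearMap.congr_fun h w

theorem finrank_eq_of_isCompl_ker {𝕜 V W : Type*} [Field 𝕜] [AddCommGroup V] [Module 𝕜 V]
    [FiniteDimensional 𝕜 V] [AddCommGroup W] [Module 𝕜 W] {T : V →ₗ[𝕜] W} {m : Submodule 𝕜 V}
    (hm : IsCompl T.ker m) : Module.finrank 𝕜 m = Module.finrank 𝕜 T.range := by
  have hsum := Submodule.finrank_add_eq_of_isCompl hm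
  have hrank := T.finrank_range_add_finrank_ker
  omega

theorem bijective_coprod_domRestrict {𝕜 V W N : Type*} [Field 𝕜] [AddCommGroup V] [Module 𝕜 V]
    [AddCommGroup W] [Module 𝕜 W] [AddCommGroup N] [Module 𝕜 N] {T : V →ₗ[𝕜] W} {S : N →ₗ[𝕜] W}
    {m : Submodule 𝕜 V} (hm : IsCompl T.ker m) (hS : Function.Injective S)
    (hTS : IsCompl T.range S.range) :
    Function.Bijective ((T.domRestrict m).coprod S) := by
  have hrange : (T.domRestrict m).range = T.range :=
    (LinearMap.range_domRestrict m T).trans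
      (Submodule.map_eq_range_iff.2 hm.codisjoint.symm)
  refine ⟨?_, ?_⟩
  · rw [← LinearMap.ker_eq_bot, LinearMap.ker_coprod_of_disjoint_range _ _
      (hrange ▸ hTS.disjoint), LinearMap.ker_eq_bot.2 hS, LinearMap.ker_eq_bot.2
      (LinearMap.injective_domRestrict_iff.2 hm.disjoint.symm), Submodule.prod_bot]
  · rw [← LinearMap.range_eq_top, LinearMap.range_coprod, hrange, hTS.sup_eq_top]

theorem isInvertible_of_bijective {V W : Type*} [NormedAddCommGroup V] [NormedSpace ℝ V]
    [FiniteDimensional ℝ V] [NormedAddCommGroup W] [NormedSpace ℝ W]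
    {T : V →L[ℝ] W} (hT : Function.Bijective T) : T.IsInvertible := by
  have : FiniteDimensional ℝ W := Module.Finite.of_surjective T.toLinearMap hT.2
  exact ⟨(LinearEquiv.ofBijective T.toLinearMap hT).toContinuousLinearEquiv, rfl⟩

section Tube

variable {EA EM V : Type*} [NormedAddCommGroup EA] [NormedSpace ℝ EA]
  [NormedAddCommGroup EM] [NormedSpace ℝ EM] [NormedAddCommGroup V] [NormedSpace ℝ V]
  {A : Type*} [TopologicalSpace A] [ChartedSpace EA A] [Group A]
  {M : Type*} [TopologicalSpace M] [ChartedSpace EM M] [MulAction A M]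

variable (EA EM) in
/-- The pair `(c, s)` is a tube around the orbit of `x` with slice `σ`: near `x`, every point is
`y = c y • σ (s y)`, where `c y` depends only on the place of `y` along the orbit of `x` and `s y`
is a transverse coordinate, constant along the orbits of dimension at most that of `x`. -/
structure IsTube (σ : V → M) (x : M) (c : M → A) (s : M → V) : Prop where
  smoothNear_c : SmoothNear EM EA c x
  smoothNear_s : SmoothNear EM V s x
  c_self : c x = 1
  s_self : s x = 0
  c_smul_s : ∀ᶠ y in 𝓝 x, c y • σ (s y) = y
  c_s_smul : ∀ᶠ z : M × V in 𝓝 (x, 0), c (c z.1 • σ z.2) = c z.1 ∧ s (c z.1 • σ z.2) = z.2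
  mderiv_s_comp : ∀ᶠ y in 𝓝 x, Module.finrank ℝ (infAction EA EM A y).range ≤
    Module.finrank ℝ (infAction EA EM A x).range →
      (mderiv EM V s y).comp (infAction EA EM A y) = 0

variable [LieGroup 𝓘(ℝ, EA) ∞ A] [ContMDiffSMul 𝓘(ℝ, EA) 𝓘(ℝ, EM) ∞ A M]
  {x : M} {σ : V → M}

section

variable {W : Type*} [NormedAddCommGroup W] [NormedSpace ℝ W] {θ : W → A}

omit [LieGroup 𝓘(ℝ, EA) ∞ A] in
theorem smoothNear_smul_prod {z : W × V} (hθ : SmoothNear W EA θ z.1)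
    (hσ : SmoothNear V EM σ z.2) :
    SmoothNear (W × V) EM (fun z : W × V ↦ θ z.1 • σ z.2) z :=
  (hθ.comp (smoothNear_fst z)).smul (hσ.comp (smoothNear_snd z))

theorem mderiv_smul_prod_apply (hθ : SmoothNear W EA θ 0) (hθ1 : θ 0 = 1)
    (hσ : SmoothNear V EM σ 0) (z : W × V) :
    mderiv (W × V) EM (fun z : W × V ↦ θ z.1 • σ z.2) 0 z =
      infAction EA EM A (σ 0) (mderiv W EA θ 0 z.1) + mderiv V EM σ 0 z.2 := by
  rw [mderiv_prod_apply (smoothNear_smul_prod hθ hσ)]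
  simp only [Prod.fst_zero, Prod.snd_zero]
  rw [mderiv_smul_const hθ]
  simp only [hθ1, one_smul, inv_one, mul_one, ContinuousLinearMap.comp_apply]

end

variable [FiniteDimensional ℝ EA]

theorem mderiv_comp_infAction_eq_zero {m : Submodule ℝ EA} {φ : EA → A} {u : M → m} {s : M → V}
    {y : M} (hu : SmoothNear EM m u y) (hs : SmoothNear EM V s y)
    (hφ : SmoothNear EA EA φ (u y)) (hy : φ (u y) • σ (s y) = y)
    (huF : ∀ᶠ a : m in 𝓝 (u y), u (φ a • σ (s y)) = a)
    (hsF : ∀ᶠ a : m in 𝓝 (u y), s (φ a • σ (s y)) = s y)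
    (hrank : Module.finrank ℝ (infAction EA EM A y).range ≤ Module.finrank ℝ m) :
    (mderiv EM V s y).comp (infAction EA EM A y) = 0 := by
  have hφm : SmoothNear m EA (fun a : m ↦ φ a) (u y) :=
    hφ.comp (smoothNear_of_contMDiff m.subtypeL.contDiff.contMDiff _)
  have horb : SmoothNear m EM (fun a : m ↦ φ a • σ (s y)) (u y) :=
    hφm.smul (smoothNear_const _ _)
  set J := mderiv m EA (fun a : m ↦ φ a * (φ (u y))⁻¹) (u y)
  have hDorb : mderiv m EM (fun a : m ↦ φ a • σ (s y)) (u y) =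
      (infAction EA EM A y).comp J := by rw [mderiv_smul_const hφm, hy]
  have hu' : (mderiv EM m u y).comp ((infAction EA EM A y).comp J) = .id ℝ m :=
    hDorb ▸ mderiv_comp_mderiv_eq_id hu horb hy huF
  have hs' : (mderiv EM V s y).comp ((infAction EA EM A y).comp J) = 0 := by
    rw [← hDorb, ← mderiv_comp hs horb hy, mderiv_congr hsF, mderiv_const]
  have hinj : Function.Injective ((infAction EA EM A y).comp J) :=
    Function.LeftInverse.injective fun a ↦ DFunLike.congr_fun hu' a
  ext v
  exact LinearMap.congr_fun (comp_eq_zero_of_finrank_range_le (J := J.toLinearMap) hinj hrank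
    (LinearMap.ext fun a ↦ DFunLike.congr_fun hs' a)) v

variable [FiniteDimensional ℝ V] [IsManifold 𝓘(ℝ, EM) ∞ M]

theorem exists_smooth_inverse_smul_prod {m : Submodule ℝ EA} {φ : EA → A}
    (hφ : SmoothNear EA EA φ 0) (hφ1 : φ 0 = 1) (hDφ : mderiv EA EA φ 0 = .id ℝ EA)
    (hσ : SmoothNear V EM σ 0) (hm : IsCompl (infAction EA EM A (σ 0)).ker m)
    (hinj : Function.Injective (mderiv V EM σ 0))
    (hcompl : IsCompl (infAction EA EM A (σ 0)).range (mderiv V EM σ 0).range) :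
    ∃ g : M → m × V, g (σ 0) = 0 ∧ SmoothNear EM (m × V) g (σ 0) ∧
      (∀ᶠ z : m × V in 𝓝 0, g (φ z.1 • σ z.2) = z) ∧
      ∀ᶠ y in 𝓝 (σ 0), φ (g y).1 • σ (g y).2 = y := by
  have hincl : SmoothNear m EA (fun a : m ↦ (a : EA)) 0 :=
    smoothNear_of_contMDiff m.subtypeL.contDiff.contMDiff _
  have hDincl : mderiv m EA (fun a : m ↦ (a : EA)) 0 = m.subtypeL :=
    (mderiv_eq_fderiv _ _).trans m.subtypeL.fderiv
  have hφm : SmoothNear m EA (fun a : m ↦ φ a) 0 := hφ.comp_of_eq hincl rfl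
  have hDφm : mderiv m EA (fun a : m ↦ φ a) 0 = m.subtypeL := by
    rw [mderiv_comp hφ hincl rfl, hDφ, hDincl, ContinuousLinearMap.id_comp]
  have hF : SmoothNear (m × V) EM (fun z : m × V ↦ φ z.1 • σ z.2) 0 :=
    smoothNear_smul_prod (θ := fun a : m ↦ φ a) (z := 0) hφm hσ
  have hF0 : φ ((0 : m × V).1) • σ (0 : m × V).2 = σ 0 := by simp [hφ1]
  have hbij : Function.Bijective (mderiv (m × V) EM (fun z : m × V ↦ φ z.1 • σ z.2) 0) := by
    convert bijective_coprod_domRestrict hm hinj hcompl using 1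
    ext z
    rw [mderiv_smul_prod_apply hφm hφ1 hσ, hDφm]
    rfl
  have hloc := exists_smooth_local_inverse hF (isInvertible_of_bijective hbij)
  rwa [hF0] at hloc

theorem exists_isTube (hσ : SmoothNear V EM σ 0) (hσx : σ 0 = x)
    (hinj : Function.Injective (mderiv V EM σ 0))
    (hcompl : IsCompl (infAction EA EM A x).range (mderiv V EM σ 0).range) :
    ∃ (c : M → A) (s : M → V), IsTube EA EM σ x c s := by
  subst hσx
  obtain ⟨φ, -, hφ, -, hφ1, -, hDφ, -⟩ := exists_centered_chart EA (1 : A)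
  obtain ⟨m, hm⟩ := (infAction EA EM A (σ 0)).ker.exists_isCompl
  obtain ⟨g, hg0, hg, hgF, hFg⟩ := exists_smooth_inverse_smul_prod hφ hφ1 hDφ hσ hm hinj hcompl
  have hu : SmoothNear EM m (fun y ↦ (g y).1) (σ 0) := (smoothNear_fst _).comp hg
  have hs : SmoothNear EM V (fun y ↦ (g y).2) (σ 0) := (smoothNear_snd _).comp hg
  have hu0 : (g (σ 0)).1 = 0 := by rw [hg0, Prod.fst_zero]
  have hs0 : (g (σ 0)).2 = 0 := by rw [hg0, Prod.snd_zero]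
  have hφu : SmoothNear EM EA (fun y ↦ φ (g y).1) (σ 0) :=
    hφ.comp_of_eq ((smoothNear_of_contMDiff m.subtypeL.contDiff.contMDiff _).comp hu)
      (by rw [hu0]; rfl)
  refine ⟨fun y ↦ φ (g y).1, fun y ↦ (g y).2, hφu, hs, by simp [hu0, hφ1], hs0, hFg, ?_, ?_⟩
  · have hcont : Tendsto (fun z : M × V ↦ ((g z.1).1, z.2)) (𝓝 (σ 0, 0)) (𝓝 (0, 0)) :=
      ((hu.tendsto hu0).comp (tendsto_fst.mono_left nhds_prod_eq.le)).prodMk_nhds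
        (tendsto_snd.mono_left nhds_prod_eq.le)
    filter_upwards [hcont.eventually hgF] with z hz
    rw [hz]
    exact ⟨rfl, rfl⟩
  · have hcoe : Tendsto (fun y ↦ ((g y).1 : EA)) (𝓝 (σ 0)) (𝓝 0) :=
      (continuous_subtype_val.tendsto' 0 0 rfl).comp (hu.tendsto hu0)
    filter_upwards [hu.eventually, hs.eventually, hcoe.eventually hφ.eventually, hFg,
      (hg.tendsto hg0).eventually hgF.eventually_nhds] with y huy hsy hφy hy hgy hrank
    have hslice : Tendsto (fun a : m ↦ (a, (g y).2)) (𝓝 (g y).1) (𝓝 (g y)) :=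
      (continuous_id.prodMk continuous_const).continuousAt
    refine mderiv_comp_infAction_eq_zero (m := m) huy hsy hφy hy ?_ ?_
      (by rwa [finrank_eq_of_isCompl_ker hm])
    · filter_upwards [hslice.eventually hgy] with a ha using congrArg Prod.fst ha
    · filter_upwards [hslice.eventually hgy] with a ha using by rw [ha]

end Tube

section Orbit

variable {E EA EM V : Type*} [NormedAddCommGroup E] [NormedSpace ℝ E]
  [NormedAddCommGroup EA] [NormedSpace ℝ EA]
  [NormedAddCommGroup EM] [NormedSpace ℝ EM] [NormedAddCommGroup V] [NormedSpace ℝ V]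
  {X : Type*} [TopologicalSpace X] [ChartedSpace E X] [IsManifold 𝓘(ℝ, E) ∞ X]
  {A : Type*} [TopologicalSpace A] [ChartedSpace EA A] [Group A] [LieGroup 𝓘(ℝ, EA) ∞ A]
  {M : Type*} [TopologicalSpace M] [ChartedSpace EM M] [MulAction A M]
  [ContMDiffSMul 𝓘(ℝ, EA) 𝓘(ℝ, EM) ∞ A M] {x : M}

theorem mderiv_smul_apply {θ : X → A} {f : X → M} {p : X} (hθ : SmoothNear E EA θ p)
    (hθp : θ p = 1) (hf : SmoothNear E EM f p) (v : E) :
    mderiv E EM (fun q ↦ θ q • f q) p v =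
      infAction EA EM A (f p) (mderiv E EA θ p v) + mderiv E EM f p v := by
  obtain ⟨φ, -, hφ, -, hφ0, -, hDφ, -⟩ := exists_centered_chart E p
  have hθφ : SmoothNear E EA (fun w ↦ θ (φ w)) 0 := hθ.comp_of_eq hφ hφ0
  have hfφ : SmoothNear E EM (fun w ↦ f (φ w)) 0 := hf.comp_of_eq hφ hφ0
  have hdiag : SmoothNear E (E × E) (fun w : E ↦ (w, w)) 0 :=
    smoothNear_of_contMDiff (contDiff_id.prodMk contDiff_id).contMDiff 0
  have hDdiag : mderiv E (E × E) (fun w : E ↦ (w, w)) 0 v = (v, v) := by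
    rw [mderiv_eq_fderiv, differentiableAt_fun_id.fderiv_prodMk differentiableAt_fun_id,
      fderiv_fun_id]
    rfl
  have hF := smoothNear_smul_prod (θ := fun w ↦ θ (φ w)) (z := 0) hθφ hfφ
  calc mderiv E EM (fun q ↦ θ q • f q) p v
      = mderiv E EM (fun w ↦ θ (φ w) • f (φ w)) 0 v := by
        rw [mderiv_comp (hθ.smul hf) hφ hφ0, hDφ, ContinuousLinearMap.comp_id]
    _ = mderiv (E × E) EM (fun z : E × E ↦ θ (φ z.1) • f (φ z.2)) 0 (v, v) := by
        rw [mderiv_comp hF hdiag rfl, ContinuousLinearMap.comp_apply, hDdiag]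
    _ = _ := by
        rw [mderiv_smul_prod_apply hθφ (by rw [hφ0, hθp]) hfφ, hφ0, mderiv_comp hθ hφ hφ0,
          mderiv_comp hf hφ hφ0, hDφ, ContinuousLinearMap.comp_id, ContinuousLinearMap.comp_id]

omit [LieGroup 𝓘(ℝ, EA) ∞ A] [ContMDiffSMul 𝓘(ℝ, EA) 𝓘(ℝ, EM) ∞ A M] in
theorem IsTube.eventually_s_eq_zero {σ : V → M} {c : M → A} {s : M → V}
    (h : IsTube EA EM σ x c s) {β : X → M} {p : X} (hβ : SmoothNear E EM β p) (hβp : β p = x)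
    (hDβ : ∀ᶠ q in 𝓝 p, (mderiv E EM β q).range ≤ (infAction EA EM A (β q)).range)
    (hrank : ∀ᶠ q in 𝓝 p, Module.finrank ℝ (infAction EA EM A (β q)).range ≤
      Module.finrank ℝ (infAction EA EM A x).range) : ∀ᶠ q in 𝓝 p, s (β q) = 0 := by
  have hsβ : SmoothNear E V (fun q ↦ s (β q)) p := h.smoothNear_s.comp_of_eq hβ hβp
  have hzero : ∀ᶠ q in 𝓝 p, mderiv E V (fun q ↦ s (β q)) q = 0 := by
    filter_upwards [hβ.eventually, (hβ.tendsto hβp).eventually h.smoothNear_s.eventually,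
      (hβ.tendsto hβp).eventually h.mderiv_s_comp, hDβ, hrank] with q hβq hsq htq hDq hrq
    ext v
    obtain ⟨w, hw⟩ := hDq (LinearMap.mem_range_self _ v)
    rw [mderiv_comp hsq hβq rfl]
    exact (congrArg _ hw.symm).trans (DFunLike.congr_fun (htq hrq) w)
  simpa only [hβp, h.s_self] using eventually_eq_of_mderiv_eq_zero hsβ hzero

variable [FiniteDimensional ℝ EA] [FiniteDimensional ℝ EM] [IsManifold 𝓘(ℝ, EM) ∞ M]

variable (EA EM A) in
theorem exists_isTube_submodule (x : M) :
    ∃ (N : Submodule ℝ EM) (σ : N → M) (c : M → A) (s : M → N),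
      σ 0 = x ∧ IsTube EA EM σ x c s := by
  obtain ⟨φ, -, hφ, -, hφx, -, hDφ, -⟩ := exists_centered_chart EM x
  obtain ⟨N, hN⟩ := (infAction EA EM A x).range.exists_isCompl
  have hincl : SmoothNear N EM (fun n : N ↦ (n : EM)) 0 :=
    smoothNear_of_contMDiff N.subtypeL.contDiff.contMDiff _
  have hDσ : mderiv N EM (fun n : N ↦ φ n) 0 = N.subtypeL := by
    rw [mderiv_comp hφ hincl rfl, hDφ, ContinuousLinearMap.id_comp]
    exact (mderiv_eq_fderiv _ _).trans N.subtypeL.fderiv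
  obtain ⟨c, s, h⟩ := exists_isTube (A := A) (EA := EA) (σ := fun n : N ↦ φ n)
    (hφ.comp_of_eq hincl rfl) hφx (hDσ ▸ Subtype.val_injective)
    (by rw [hDσ]; exact N.range_subtype.symm ▸ hN)
  exact ⟨N, fun n ↦ φ n, c, s, hφx, h⟩

variable (EA EM A) in
theorem exists_smooth_lift_of_tangent (x : M) : ∃ c : M → A, SmoothNear EM EA c x ∧ c x = 1 ∧
    ∀ {β : X → M} {p : X}, SmoothNear E EM β p → β p = x →
      (∀ᶠ q in 𝓝 p, (mderiv E EM β q).range ≤ (infAction EA EM A (β q)).range) →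
      (∀ᶠ q in 𝓝 p, Module.finrank ℝ (infAction EA EM A (β q)).range ≤
        Module.finrank ℝ (infAction EA EM A x).range) →
      ∀ᶠ q in 𝓝 p, c (β q) • x = β q := by
  obtain ⟨N, σ, c, s, hσ, h⟩ := exists_isTube_submodule EA EM A x
  refine ⟨c, h.smoothNear_c, h.c_self, fun {β p} hβ hβp hDβ hrank ↦ ?_⟩
  filter_upwards [h.eventually_s_eq_zero hβ hβp hDβ hrank,
    (hβ.tendsto hβp).eventually h.c_smul_s] with q hsq hcq
  rwa [hsq, hσ] at hcq

variable (EA EM A) in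
/-- A retraction of a neighbourhood of `1` in `A` onto the isotropy group of `x`. -/
structure IsStabilizerRetraction (x : M) (τ : A → A) : Prop where
  smoothNear : SmoothNear EA EA τ 1
  apply_of_mem : ∀ a ∈ MulAction.stabilizer A x, τ a = a
  eventually_mem : ∀ᶠ a in 𝓝 1, τ a ∈ MulAction.stabilizer A x
  mderiv_apply : ∀ v, infAction EA EM A x v = 0 → mderiv EA EA τ 1 v = v

variable (EA EM A) in
theorem exists_isStabilizerRetraction (x : M) :
    ∃ τ : A → A, IsStabilizerRetraction EA EM A x τ := by
  obtain ⟨c, hc, hcx, hlift⟩ := exists_smooth_lift_of_tangent (X := A) (E := EA) EA EM A x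
  have horb : SmoothNear EA EM (fun a : A ↦ a • x) 1 := smoothNear_smul_const x 1
  have hγ : SmoothNear EA EA (fun a : A ↦ c (a • x)) 1 := hc.comp_of_eq horb (one_smul A x)
  have hτ : SmoothNear EA EA (fun a : A ↦ (c (a • x))⁻¹ * a) 1 := hγ.inv.mul (smoothNear_id 1)
  refine ⟨fun a ↦ (c (a • x))⁻¹ * a, hτ, fun a ha ↦ ?_, ?_, fun v hv ↦ ?_⟩
  · rw [MulAction.mem_stabilizer_iff.1 ha, hcx, inv_one, one_mul]
  · filter_upwards [hlift horb (one_smul A x)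
      (.of_forall fun a ↦ range_mderiv_smul_const_le (smoothNear_id a) x)
      (.of_forall fun a ↦ (finrank_range_infAction_smul a x).le)] with a ha
    rw [MulAction.mem_stabilizer_iff, mul_smul, inv_smul_eq_iff, ha]
  · have hDγ : mderiv EA EA (fun a : A ↦ c (a • x)) 1 v = 0 := by
      rw [mderiv_comp hc horb (one_smul A x), ContinuousLinearMap.comp_apply]
      exact (congrArg _ hv).trans (map_zero _)
    have hmul := mderiv_smul_apply hγ (by rw [one_smul, hcx]) hτ v
    simp only [smul_eq_mul, mul_inv_cancel_left, hDγ, map_zero, zero_add, mderiv_id] at hmul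
    exact hmul.symm

end Orbit

section SubgroupLieAlgebra

variable {EA : Type*} [NormedAddCommGroup EA] [NormedSpace ℝ EA]
  {A : Type*} [TopologicalSpace A] [ChartedSpace EA A] [Group A]

variable (EA) in
/-- The Lie algebra `tangentAtOne EA S` of the subgroup `S`, as a subspace of the model space. -/
noncomputable def subgroupLieAlgebra (S : Subgroup A) : Submodule ℝ EA :=
  Submodule.span ℝ {v | ∃ γ : ℝ → A, ContMDiff 𝓘(ℝ, ℝ) 𝓘(ℝ, EA) ∞ γ ∧ (∀ t, γ t ∈ S) ∧
    γ 0 = 1 ∧ v = mderiv ℝ EA γ 0 1}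

theorem subgroupDim_eq_finrank (S : Subgroup A) :
    subgroupDim EA S = Module.finrank ℝ (subgroupLieAlgebra EA S) :=
  rfl

theorem subgroupLieAlgebra_mono {S T : Subgroup A} (h : S ≤ T) :
    subgroupLieAlgebra EA S ≤ subgroupLieAlgebra EA T :=
  Submodule.span_mono fun _ ⟨γ, hγ, hγS, hγ1⟩ ↦ ⟨γ, hγ, fun t ↦ h (hγS t), hγ1⟩

variable [LieGroup 𝓘(ℝ, EA) ∞ A]

theorem exists_curve_of_eventually_mem {S : Subgroup A} {τ : A → A} (hτ : SmoothNear EA EA τ 1)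
    (hτ1 : τ 1 = 1) (hτS : ∀ᶠ a in 𝓝 1, τ a ∈ S) (v : EA) :
    ∃ (ε : ℝ) (γ : ℝ → A), ε ≠ 0 ∧ ContMDiff 𝓘(ℝ, ℝ) 𝓘(ℝ, EA) ∞ γ ∧ (∀ t, γ t ∈ S) ∧
      γ 0 = 1 ∧ mderiv ℝ EA γ 0 1 = ε • mderiv EA EA τ 1 v := by
  obtain ⟨φ, -, hφ, -, hφ1, -, hDφ, -⟩ := exists_centered_chart EA (1 : A)
  have hτφ : SmoothNear EA EA (fun w ↦ τ (φ w)) 0 := hτ.comp_of_eq hφ hφ1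
  obtain ⟨r, hr, hball⟩ := Metric.eventually_nhds_iff_ball.1
    (hτφ.eventually.and ((hφ.tendsto hφ1).eventually hτS))
  obtain ⟨ε, hε, hεv⟩ : ∃ ε > 0, ε * ‖v‖ < r := exists_pos_mul_lt hr ‖v‖ |>.imp fun ε h ↦
    ⟨h.1, by linarith [mul_comm ε ‖v‖, h.2]⟩
  set γ₀ : ℝ → EA := fun t ↦ (ε * Real.sin t) • v
  have hγ₀ : ContDiff ℝ ∞ γ₀ := (contDiff_const.mul Real.contDiff_sin).smul contDiff_const
  have hγ₀_mem (t : ℝ) : γ₀ t ∈ Metric.ball (0 : EA) r := by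
    rw [mem_ball_zero_iff, norm_smul, norm_mul, Real.norm_of_nonneg hε.le]
    refine lt_of_le_of_lt ?_ hεv
    gcongr
    exact mul_le_of_le_one_right hε.le (Real.abs_sin_le_one t)
  have hγ₀0 : γ₀ 0 = 0 := by simp [γ₀]
  have hDγ₀ : mderiv ℝ EA γ₀ 0 1 = ε • v := by
    rw [mderiv_eq_fderiv, fderiv_apply_one_eq_deriv]
    simpa using (((Real.hasDerivAt_sin 0).const_mul ε).smul_const v).deriv
  refine ⟨ε, fun t ↦ τ (φ (γ₀ t)), hε.ne', fun t ↦ ?_, fun t ↦ (hball _ (hγ₀_mem t)).2, ?_, ?_⟩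
  · exact ((hball _ (hγ₀_mem t)).1.comp_of_eq (smoothNear_of_contMDiff hγ₀.contMDiff t)
      rfl).contMDiffAt
  · simp only [hγ₀0, hφ1, hτ1]
  · rw [mderiv_comp hτφ (smoothNear_of_contMDiff hγ₀.contMDiff 0) hγ₀0,
      ContinuousLinearMap.comp_apply, hDγ₀, mderiv_comp hτ hφ hφ1, hDφ,
      ContinuousLinearMap.comp_id, map_smul]

end SubgroupLieAlgebra

section Isotropy

variable {EA EM : Type*} [NormedAddCommGroup EA] [NormedSpace ℝ EA] [FiniteDimensional ℝ EA]
  [NormedAddCommGroup EM] [NormedSpace ℝ EM] [FiniteDimensional ℝ EM]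
  {A : Type*} [TopologicalSpace A] [ChartedSpace EA A] [Group A] [LieGroup 𝓘(ℝ, EA) ∞ A]
  {M : Type*} [TopologicalSpace M] [ChartedSpace EM M] [IsManifold 𝓘(ℝ, EM) ∞ M]
  [MulAction A M] [ContMDiffSMul 𝓘(ℝ, EA) 𝓘(ℝ, EM) ∞ A M]

variable (EA EM) in
theorem subgroupLieAlgebra_stabilizer (x : M) :
    subgroupLieAlgebra EA (MulAction.stabilizer A x) = (infAction EA EM A x).ker := by
  refine le_antisymm (Submodule.span_le.2 ?_) fun v hv ↦ ?_
  · rintro _ ⟨γ, hγ, hγS, hγ1, rfl⟩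
    have hγ0 := mderiv_smul_const (EM := EM) (smoothNear_of_contMDiff hγ 0) x
    simp only [MulAction.mem_stabilizer_iff.1 (hγS _), hγ1, inv_one, mul_one, one_smul,
      mderiv_const] at hγ0
    exact (DFunLike.congr_fun hγ0 1).symm
  · obtain ⟨τ, hτ⟩ := exists_isStabilizerRetraction EA EM A x
    obtain ⟨ε, γ, hε, hγ, hγS, hγ1, hγ'⟩ := exists_curve_of_eventually_mem hτ.smoothNear
      (hτ.apply_of_mem 1 (one_mem _)) hτ.eventually_mem v
    rw [hτ.mderiv_apply v hv] at hγ'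
    exact (Submodule.smul_mem_iff _ hε).1 (Submodule.subset_span ⟨γ, hγ, hγS, hγ1, hγ'.symm⟩)

variable (EM) in
theorem ker_infAction_eq_of_stabilizer_le {x y : M}
    (hle : MulAction.stabilizer A y ≤ MulAction.stabilizer A x)
    (hdim : subgroupDim EA (MulAction.stabilizer A y) = subgroupDim EA (MulAction.stabilizer A x)) :
    (infAction EA EM A y).ker = (infAction EA EM A x).ker := by
  rw [← subgroupLieAlgebra_stabilizer, ← subgroupLieAlgebra_stabilizer]
  exact Submodule.eq_of_le_of_finrank_eq (subgroupLieAlgebra_mono hle) hdim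

variable (EA EM) in
include EM in
theorem eventually_mem_stabilizer_of_le {x y : M}
    (hle : MulAction.stabilizer A y ≤ MulAction.stabilizer A x)
    (hdim : subgroupDim EA (MulAction.stabilizer A y) = subgroupDim EA (MulAction.stabilizer A x)) :
    ∀ᶠ a in 𝓝 (1 : A), a ∈ MulAction.stabilizer A x → a ∈ MulAction.stabilizer A y := by
  obtain ⟨τ, hτ⟩ := exists_isStabilizerRetraction EA EM A x
  have hτ1 : τ 1 = 1 := hτ.apply_of_mem 1 (one_mem _)
  have hker (a : A) (v : EA) :
      infAction EA EM A (a • x) v = 0 → infAction EA EM A (a • y) v = 0 := by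
    have hv : v = Ad EA a (Ad EA a⁻¹ v) := (DFunLike.congr_fun (Ad_comp_Ad_inv a) v).symm
    rw [hv, infAction_eq_zero_iff_Ad, infAction_eq_zero_iff_Ad]
    exact (SetLike.ext_iff.1 (ker_infAction_eq_of_stabilizer_le EM hle hdim) _).2
  have hconst : ∀ᶠ a in 𝓝 (1 : A), τ a • y = τ 1 • y := by
    refine eventually_eq_of_mderiv_eq_zero (E := EA) (F := EM)
      (hτ.smoothNear.smul (smoothNear_const y 1)) ?_
    filter_upwards [hτ.smoothNear.eventually, hτ.eventually_mem.eventually_nhds] with a hτa hmem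
    have hfix : ∀ᶠ b in 𝓝 a, τ b • x = x := hmem
    have hDx := mderiv_smul_const (EM := EM) hτa x
    rw [mderiv_congr hfix, mderiv_const] at hDx
    rw [mderiv_smul_const hτa]
    ext v
    exact hker _ _ (DFunLike.congr_fun hDx v).symm
  filter_upwards [hconst] with a ha hax
  rwa [hτ.apply_of_mem a hax, hτ1, one_smul] at ha

end Isotropy

section IdentityComponent

variable {G : Type*} [TopologicalSpace G] [Group G] [IsTopologicalGroup G]

theorem coe_identityComponent (S : Subgroup G) :
    (identityComponent S : Set G) = connectedComponentIn (S : Set G) 1 := by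
  rw [connectedComponentIn_eq_image (F := (S : Set G)) S.one_mem]
  rfl

theorem identityComponent_map (α : G ≃* G) (hα : Continuous α) (hα' : Continuous α.symm)
    (S : Subgroup G) :
    identityComponent (S.map α.toMonoidHom) = (identityComponent S).map α.toMonoidHom := by
  let e : G ≃ₜ G := ⟨α.toEquiv, hα, hα'⟩
  have himage := e.image_connectedComponentIn (s := (S : Set G)) S.one_mem
  rw [show e 1 = 1 from map_one α] at himage
  apply SetLike.coe_injective
  rw [coe_identityComponent, Subgroup.coe_map, Subgroup.coe_map, coe_identityComponent]
  exact himage.symm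

theorem identityComponent_eq_of_eventually {S T : Subgroup G} (hle : S ≤ T)
    (h : ∀ᶠ t in 𝓝 (1 : G), t ∈ T → t ∈ S) : identityComponent S = identityComponent T := by
  apply SetLike.coe_injective
  rw [coe_identityComponent, coe_identityComponent]
  refine subset_antisymm (connectedComponentIn_mono _ hle) ?_
  have hopen : IsOpen (S.subgroupOf T : Set T) := by
    refine Subgroup.isOpen_of_mem_nhds (g := 1) _ ?_
    filter_upwards [(continuous_subtype_val.tendsto (1 : T)).eventually h] with t ht
    exact Subgroup.mem_subgroupOf.2 (ht t.2)
  have hclopen : IsClopen (S.subgroupOf T : Set T) :=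
    ⟨Subgroup.isClosed_of_isOpen _ hopen, hopen⟩
  refine isPreconnected_connectedComponentIn.subset_connectedComponentIn
    (mem_connectedComponentIn T.one_mem) ?_
  rw [connectedComponentIn_eq_image (F := (T : Set G)) T.one_mem]
  rintro _ ⟨t, ht, rfl⟩
  exact hclopen.connectedComponent_subset (S.subgroupOf T).one_mem ht

end IdentityComponent

section Homomorphism

variable {EG EK : Type*} [NormedAddCommGroup EG] [NormedSpace ℝ EG]
  [NormedAddCommGroup EK] [NormedSpace ℝ EK]
  {G : Type*} [TopologicalSpace G] [ChartedSpace EG G] [Group G]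
  {K : Type*} [TopologicalSpace K] [ChartedSpace EK K] [Group K]

theorem subgroupLieAlgebra_map_le (α : G →* K) (hα : ContMDiff 𝓘(ℝ, EG) 𝓘(ℝ, EK) ∞ α)
    (S : Subgroup G) :
    (subgroupLieAlgebra EG S).map (mderiv EG EK α 1 : EG →ₗ[ℝ] EK) ≤
      subgroupLieAlgebra EK (S.map α) := by
  refine Submodule.map_le_iff_le_comap.2 (Submodule.span_le.2 ?_)
  rintro _ ⟨γ, hγ, hγS, hγ1, rfl⟩
  refine Submodule.subset_span ⟨fun t ↦ α (γ t), hα.comp hγ, fun t ↦ ⟨γ t, hγS t, rfl⟩,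
    (congrArg α hγ1).trans (map_one α), ?_⟩
  rw [mderiv_comp (smoothNear_of_contMDiff hα 1) (smoothNear_of_contMDiff hγ 0) hγ1]
  rfl

theorem injective_mderiv_mulEquiv (α : G ≃* K) (hα : ContMDiff 𝓘(ℝ, EG) 𝓘(ℝ, EK) ∞ α)
    (hα' : ContMDiff 𝓘(ℝ, EK) 𝓘(ℝ, EG) ∞ α.symm) : Function.Injective (mderiv EG EK α 1) := by
  refine Function.LeftInverse.injective (g := mderiv EK EG α.symm 1) fun v ↦ ?_
  exact DFunLike.congr_fun (mderiv_comp_mderiv_eq_id (smoothNear_of_contMDiff hα' 1)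
    (smoothNear_of_contMDiff hα 1) (map_one α) (.of_forall α.symm_apply_apply)) v

theorem subgroupDim_le_map [FiniteDimensional ℝ EK] (α : G ≃* K)
    (hα : ContMDiff 𝓘(ℝ, EG) 𝓘(ℝ, EK) ∞ α) (hα' : ContMDiff 𝓘(ℝ, EK) 𝓘(ℝ, EG) ∞ α.symm)
    (S : Subgroup G) : subgroupDim EG S ≤ subgroupDim EK (S.map α.toMonoidHom) := by
  rw [subgroupDim_eq_finrank, subgroupDim_eq_finrank]
  exact (Submodule.equivMapOfInjective (mderiv EG EK α 1 : EG →ₗ[ℝ] EK)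
    (injective_mderiv_mulEquiv α hα hα') _).finrank_eq.le.trans
    (Submodule.finrank_mono (subgroupLieAlgebra_map_le α.toMonoidHom hα S))

theorem subgroupDim_map [FiniteDimensional ℝ EG] [FiniteDimensional ℝ EK] (α : G ≃* K)
    (hα : ContMDiff 𝓘(ℝ, EG) 𝓘(ℝ, EK) ∞ α) (hα' : ContMDiff 𝓘(ℝ, EK) 𝓘(ℝ, EG) ∞ α.symm)
    (S : Subgroup G) : subgroupDim EK (S.map α.toMonoidHom) = subgroupDim EG S := by
  refine le_antisymm ?_ (subgroupDim_le_map α hα hα' S)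
  have hle := subgroupDim_le_map α.symm hα' hα (S.map α.toMonoidHom)
  have hid : α.symm.toMonoidHom.comp α.toMonoidHom = .id G :=
    MonoidHom.ext α.symm_apply_apply
  rwa [Subgroup.map_map, hid, Subgroup.map_id] at hle

theorem contMDiff_of_smoothNear_one [LieGroup 𝓘(ℝ, EG) ∞ G] [LieGroup 𝓘(ℝ, EK) ∞ K] {α : G →* K}
    (hα : SmoothNear EG EK α 1) : ContMDiff 𝓘(ℝ, EG) 𝓘(ℝ, EK) ∞ α := fun g ↦ by
  have htranslate : SmoothNear EG EK (fun l : G ↦ α g * α (g⁻¹ * l)) g :=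
    (smoothNear_const _ _).mul (hα.comp_of_eq
      ((smoothNear_const (g⁻¹ : G) g).mul (smoothNear_id g)) (inv_mul_cancel g))
  simpa only [← map_mul, mul_inv_cancel_left] using htranslate.contMDiffAt

end Homomorphism

section DenseSubgroup

variable {EG EK : Type*} [NormedAddCommGroup EG] [NormedSpace ℝ EG]
  [NormedAddCommGroup EK] [NormedSpace ℝ EK] [FiniteDimensional ℝ EK]
  {G : Type*} [TopologicalSpace G] [ChartedSpace EG G] [Group G] [LieGroup 𝓘(ℝ, EG) ∞ G]
  {K : Type*} [TopologicalSpace K] [ChartedSpace EK K] [Group K] [LieGroup 𝓘(ℝ, EK) ∞ K]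
  {ι : G →* K}

omit [FiniteDimensional ℝ EK] [LieGroup 𝓘(ℝ, EG) ∞ G] in
theorem mderiv_conj_hom (hι : ContMDiff 𝓘(ℝ, EG) 𝓘(ℝ, EK) ∞ ι) (k : K) :
    mderiv EG EK (fun g ↦ k * ι g * k⁻¹) 1 = (Ad EK k).comp (mderiv EG EK ι 1) :=
  mderiv_comp (smoothNear_mul_mul k k⁻¹ 1) (smoothNear_of_contMDiff hι 1) (map_one ι)

/-- The preimage under `k ↦ Ad k v` of the closed subspace `range Dι` contains the dense subgroup
`ι(G)`. -/
theorem Ad_mem_range_mderiv (hι : ContMDiff 𝓘(ℝ, EG) 𝓘(ℝ, EK) ∞ ι) (hd : DenseRange ι) (k : K)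
    (v : EG) : Ad EK k (mderiv EG EK ι 1 v) ∈ (mderiv EG EK ι 1).range := by
  have hclosed : IsClosed {k : K | Ad EK k (mderiv EG EK ι 1 v) ∈ (mderiv EG EK ι 1).range} :=
    (Submodule.closed_of_finiteDimensional _).preimage (continuous_Ad.clm_apply continuous_const)
  refine hd.induction_on (p := fun k ↦ Ad EK k (mderiv EG EK ι 1 v) ∈ _) k hclosed fun g ↦ ?_
  rw [← ContinuousLinearMap.comp_apply, ← mderiv_conj_hom hι]
  simp only [← map_mul, ← map_inv]
  rw [mderiv_comp (smoothNear_of_contMDiff hι 1) (smoothNear_mul_mul g g⁻¹ 1) (by group)]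
  exact ⟨_, rfl⟩

theorem range_mderiv_conj_hom_le (hι : ContMDiff 𝓘(ℝ, EG) 𝓘(ℝ, EK) ∞ ι) (hd : DenseRange ι)
    (k : K) (g : G) : (mderiv EG EK (fun l ↦ k * ι l * k⁻¹) g).range ≤
      (mderiv EG EK (fun l ↦ ι l * (k * ι g * k⁻¹)) 1).range := by
  have hshift : mderiv EG EK (fun l ↦ k * ι l * k⁻¹ * (k * ι g * k⁻¹)⁻¹) g =
      ((Ad EK k).comp (mderiv EG EK ι 1)).comp (mderiv EG EG (fun l : G ↦ l * g⁻¹) g) := by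
    rw [← mderiv_conj_hom hι, ← mderiv_comp ((smoothNear_mul_mul k k⁻¹ (ι 1)).comp
      (smoothNear_of_contMDiff hι 1)) ((smoothNear_id g).mul (smoothNear_const _ _))
      (mul_inv_cancel g)]
    congr 1 with l
    rw [map_mul, map_inv]
    group
  have hleft := mderiv_smul_const (EM := EK) ((smoothNear_mul_mul k k⁻¹ (ι g)).comp
    (smoothNear_of_contMDiff hι g)) (1 : K)
  have hright := mderiv_smul_const (EM := EK) (smoothNear_of_contMDiff hι 1) (k * ι g * k⁻¹)
  simp only [smul_eq_mul, mul_one, map_one, one_mul, inv_one] at hleft hright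
  rw [hleft, hright, hshift]
  rintro _ ⟨v, rfl⟩
  obtain ⟨w, hw⟩ := Ad_mem_range_mderiv hι hd k (mderiv EG EG (fun l : G ↦ l * g⁻¹) g v)
  exact ⟨w, congrArg _ hw⟩

omit [LieGroup 𝓘(ℝ, EG) ∞ G] in
theorem finrank_range_mderiv_hom_mul_le (hι : ContMDiff 𝓘(ℝ, EG) 𝓘(ℝ, EK) ∞ ι) (y : K) :
    Module.finrank ℝ (mderiv EG EK (fun l ↦ ι l * y) 1).range ≤
      Module.finrank ℝ (mderiv EG EK (fun l ↦ ι l * 1) 1).range := by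
  have hfactor : mderiv EG EK (fun l ↦ ι l * y) 1 =
      (mderiv EK EK (· * y) 1).comp (mderiv EG EK (fun l ↦ ι l * 1) 1) := by
    simp only [mul_one]
    exact mderiv_comp ((smoothNear_id 1).mul (smoothNear_const y 1))
      (smoothNear_of_contMDiff hι 1) (map_one ι)
  rw [hfactor]
  exact (congrArg (fun S : Submodule ℝ EK ↦ Module.finrank ℝ S) (LinearMap.range_comp _ _)).trans_le
    (Submodule.finrank_map_le _ _)

variable [FiniteDimensional ℝ EG]

theorem exists_smooth_lift_conj (hι : ContMDiff 𝓘(ℝ, EG) 𝓘(ℝ, EK) ∞ ι) (hd : DenseRange ι)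
    (k : K) : ∃ c : G → G, SmoothNear EG EG c 1 ∧ ∀ᶠ g in 𝓝 (1 : G), ι (c g) = k * ι g * k⁻¹ := by
  let _ : MulAction G K := MulAction.compHom K ι
  have : ContMDiffSMul 𝓘(ℝ, EG) 𝓘(ℝ, EK) ∞ G K := MulAction.contMDiffSMul_compHom hι
  have hβ (g : G) : SmoothNear EG EK (fun g ↦ k * ι g * k⁻¹) g :=
    (smoothNear_mul_mul k k⁻¹ (ι g)).comp (smoothNear_of_contMDiff hι g)
  have hβ1 : k * ι 1 * k⁻¹ = 1 := by rw [map_one, mul_one, mul_inv_cancel]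
  obtain ⟨c, hc, -, hlift⟩ := exists_smooth_lift_of_tangent (X := G) (E := EG) EG EK G (1 : K)
  refine ⟨fun g ↦ c (k * ι g * k⁻¹), hc.comp_of_eq (hβ 1) hβ1, ?_⟩
  filter_upwards [hlift (hβ 1) hβ1 (.of_forall (range_mderiv_conj_hom_le hι hd k))
    (.of_forall fun g ↦ finrank_range_mderiv_hom_mul_le hι _)] with g hg
  exact (mul_one _).symm.trans hg

theorem range_normal [IsTopologicalGroup G] [ConnectedSpace G]
    (hι : ContMDiff 𝓘(ℝ, EG) 𝓘(ℝ, EK) ∞ ι) (hd : DenseRange ι) : ι.range.Normal := by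
  refine ⟨fun n ⟨g, hg⟩ k ↦ hg ▸ ?_⟩
  set S : Subgroup G := ι.range.comap ((MulAut.conj k).toMonoidHom.comp ι)
  obtain ⟨c, -, hc⟩ := exists_smooth_lift_conj hι hd k
  have hopen : IsOpen (S : Set G) := by
    refine Subgroup.isOpen_of_mem_nhds (g := 1) _ ?_
    filter_upwards [hc] with g hg
    exact ⟨c g, hg⟩
  have hS : (S : Set G) = univ :=
    IsClopen.eq_univ ⟨Subgroup.isClosed_of_isOpen _ hopen, hopen⟩ ⟨1, S.one_mem⟩
  exact show g ∈ (S : Set G) from hS ▸ mem_univ g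

variable (EG ι) in
/-- The automorphisms `α k` of `G` by which the elements `k` of `K ⊇ ι(G)` act on `G` by
conjugation are smooth. -/
structure IsSmoothConj (α : K → G ≃* G) : Prop where
  map_apply : ∀ k g, ι (α k g) = k * ι g * k⁻¹
  contMDiff : ∀ k, ContMDiff 𝓘(ℝ, EG) 𝓘(ℝ, EG) ∞ (α k)
  contMDiff_symm : ∀ k, ContMDiff 𝓘(ℝ, EG) 𝓘(ℝ, EG) ∞ (α k).symm

omit [TopologicalSpace G] [TopologicalSpace K] [ChartedSpace EG G] [ChartedSpace EK K]
  [LieGroup 𝓘(ℝ, EG) ∞ G] [LieGroup 𝓘(ℝ, EK) ∞ K] [FiniteDimensional ℝ EG]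
  [FiniteDimensional ℝ EK] in
theorem exists_mulEquiv_conj (hinj : Function.Injective ι) [ι.range.Normal] :
    ∃ α : K → G ≃* G, ∀ k g, ι (α k g) = k * ι g * k⁻¹ := by
  let e : G ≃* ι.range := MonoidHom.ofInjective hinj
  have he (z : ι.range) : ι (e.symm z) = z := congrArg Subtype.val (e.apply_symm_apply z)
  exact ⟨fun k ↦ (e.trans (MulAut.conjNormal k)).trans e.symm, fun k g ↦
    (he _).trans (MulAut.conjNormal_apply _ _)⟩

theorem exists_isSmoothConj [IsTopologicalGroup G] [ConnectedSpace G]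
    (hι : ContMDiff 𝓘(ℝ, EG) 𝓘(ℝ, EK) ∞ ι) (hinj : Function.Injective ι) (hd : DenseRange ι) :
    ∃ α : K → G ≃* G, IsSmoothConj EG ι α := by
  have := range_normal hι hd
  obtain ⟨α, hα⟩ := exists_mulEquiv_conj hinj
  have hsmooth (k : K) : ContMDiff 𝓘(ℝ, EG) 𝓘(ℝ, EG) ∞ (α k) := by
    obtain ⟨c, hc, hck⟩ := exists_smooth_lift_conj hι hd k
    refine contMDiff_of_smoothNear_one (α := (α k).toMonoidHom) (hc.congr ?_)
    filter_upwards [hck] with g hg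
    exact hinj ((hα k g).trans hg.symm)
  have hsymm (k : K) : ((α k).symm : G → G) = α k⁻¹ := by
    funext g
    refine (α k).injective (hinj ?_)
    rw [(α k).apply_symm_apply, hα, hα]
    group
  exact ⟨α, hα, hsmooth, fun k ↦ hsymm k ▸ hsmooth k⁻¹⟩

end DenseSubgroup

section ParametricIntegral

universe u

theorem hasFDerivAt_integral_of_continuousAt_fderiv {E F X : Type*}
    [NormedAddCommGroup E] [NormedSpace ℝ E] [NormedAddCommGroup F] [NormedSpace ℝ F]
    [TopologicalSpace X] [CompactSpace X] [MeasurableSpace X] [OpensMeasurableSpace X]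
    (μ : Measure X) [IsFiniteMeasure μ] {U : Set E} (hU : IsOpen U) {f : X → E → F}
    (hf : ∀ q, ∀ e ∈ U, DifferentiableAt ℝ (f q) e) (hfc : ∀ e ∈ U, Continuous fun q ↦ f q e)
    (hf' : ∀ q, ∀ e ∈ U, ContinuousAt (fun z : X × E ↦ fderiv ℝ (f z.1) z.2) (q, e))
    {e : E} (he : e ∈ U) :
    HasFDerivAt (fun e ↦ ∫ q, f q e ∂μ) (∫ q, fderiv ℝ (f q) e ∂μ) e := by
  have hf'c : Continuous fun q ↦ fderiv ℝ (f q) e := continuous_iff_continuousAt.2 fun q ↦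
    ContinuousAt.comp (f := fun q ↦ (q, e)) (hf' q e he) (by fun_prop)
  obtain ⟨C, hC⟩ := (isCompact_range hf'c.norm).bddAbove
  have hbound : ∀ᶠ e' in 𝓝 e, ∀ q ∈ (univ : Set X), ‖fderiv ℝ (f q) e'‖ < C + 1 := by
    refine isCompact_univ.eventually_forall_of_forall_eventually
      (P := fun e' q ↦ ‖fderiv ℝ (f q) e'‖ < C + 1) fun q _ ↦ ?_
    have hcont : ContinuousAt (fun z : E × X ↦ ‖fderiv ℝ (f z.2) z.1‖) (e, q) :=
      (ContinuousAt.comp (f := Prod.swap) (x := (e, q)) (hf' q e he)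
        continuous_swap.continuousAt).norm
    exact hcont.eventually_lt_const ((hC (mem_range_self q)).trans_lt (lt_add_one C))
  refine hasFDerivAt_integral_of_dominated_of_fderiv_le (𝕜 := ℝ) (F := fun e q ↦ f q e)
    (F' := fun e q ↦ fderiv ℝ (f q) e) (bound := fun _ ↦ C + 1)
    (inter_mem (hU.mem_nhds he) hbound) ?_
    ((hfc e he).integrable_of_hasCompactSupport (.of_compactSpace _))
    (hf'c.integrable_of_hasCompactSupport (.of_compactSpace _)).aestronglyMeasurable
    (ae_of_all _ fun q e' he' ↦ (he'.2 q (mem_univ q)).le) (integrable_const _)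
    (ae_of_all _ fun q e' he' ↦ (hf q e' he'.1).hasFDerivAt)
  filter_upwards [hU.mem_nhds he] with e' he'
  exact ((hfc e' he').integrable_of_hasCompactSupport (.of_compactSpace _)).aestronglyMeasurable

variable {E' P : Type*} [NormedAddCommGroup E'] [NormedSpace ℝ E'] [TopologicalSpace P]
  [ChartedSpace E' P] {E F : Type u} [NormedAddCommGroup E] [NormedSpace ℝ E]
  [NormedAddCommGroup F] [NormedSpace ℝ F]

theorem contMDiffAt_uncurry_fderiv [IsManifold 𝓘(ℝ, E') ∞ P] {f : P → E → F} {p : P} {e : E}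
    (hf : ContMDiffAt (𝓘(ℝ, E').prod 𝓘(ℝ, E)) 𝓘(ℝ, F) ∞ (Function.uncurry f) (p, e)) :
    ContMDiffAt (𝓘(ℝ, E').prod 𝓘(ℝ, E)) 𝓘(ℝ, E →L[ℝ] F) ∞
      (Function.uncurry fun p ↦ fderiv ℝ (f p)) (p, e) := by
  have h := ContMDiffAt.mfderiv (I := 𝓘(ℝ, E)) (I' := 𝓘(ℝ, F)) (J := 𝓘(ℝ, E').prod 𝓘(ℝ, E))
    (m := ∞) (n := ∞) (x₀ := (p, e)) (fun z : P × E ↦ f z.1) Prod.snd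
    (ContMDiffAt.comp (f := fun w : (P × E) × E ↦ (w.1.1, w.2)) (x := ((p, e), e)) hf
      (contMDiffAt_fst.fst.prodMk contMDiffAt_snd)) contMDiffAt_snd (by simp)
  simpa only [inTangentCoordinates_model_space, mfderiv_eq_fderiv, Function.uncurry_def] using h

variable {X : Type*} [TopologicalSpace X] {j : X → P} {U : Set E}

theorem continuousAt_apply_of_contMDiffAt_uncurry (hj : Continuous j) {f : P → E → F} {q : X}
    {e : E} (hf : ContMDiffAt (𝓘(ℝ, E').prod 𝓘(ℝ, E)) 𝓘(ℝ, F) ∞ (Function.uncurry f) (j q, e)) :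
    ContinuousAt (fun z : X × E ↦ f (j z.1) z.2) (q, e) :=
  ContinuousAt.comp (g := Function.uncurry f) (f := fun z : X × E ↦ (j z.1, z.2)) (x := (q, e))
    hf.continuousAt (by fun_prop)

theorem contDiffAt_of_contMDiffAt_uncurry {f : P → E → F} {p : P} {e : E}
    (hf : ContMDiffAt (𝓘(ℝ, E').prod 𝓘(ℝ, E)) 𝓘(ℝ, F) ∞ (Function.uncurry f) (p, e)) :
    ContDiffAt ℝ ∞ (f p) e :=
  (ContMDiffAt.comp (f := fun e ↦ (p, e)) e hf
    (contMDiffAt_const.prodMk contMDiffAt_id)).contDiffAt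

variable [CompactSpace X] [MeasurableSpace X] [OpensMeasurableSpace X] (μ : Measure X)
  [IsFiniteMeasure μ] [IsManifold 𝓘(ℝ, E') ∞ P]

theorem hasFDerivAt_integral_clm_apply {F' : Type*} [NormedAddCommGroup F'] [NormedSpace ℝ F']
    (hj : Continuous j) (hU : IsOpen U) {T : X → F →L[ℝ] F'} (hT : Continuous T) {f : P → E → F}
    (hf : ∀ q, ∀ e ∈ U,
      ContMDiffAt (𝓘(ℝ, E').prod 𝓘(ℝ, E)) 𝓘(ℝ, F) ∞ (Function.uncurry f) (j q, e))
    {e : E} (he : e ∈ U) :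
    HasFDerivAt (fun e ↦ ∫ q, T q (f (j q) e) ∂μ)
      (∫ q, (T q).comp (fderiv ℝ (f (j q)) e) ∂μ) e := by
  have hderiv : ∀ q, ∀ e ∈ U, HasFDerivAt (fun e ↦ T q (f (j q) e))
      ((T q).comp (fderiv ℝ (f (j q)) e)) e := fun q e he ↦
    (T q).hasFDerivAt.comp e
      ((contDiffAt_of_contMDiffAt_uncurry (hf q e he)).differentiableAt (by simp)).hasFDerivAt
  rw [← funext fun q ↦ (hderiv q e he).fderiv]
  refine hasFDerivAt_integral_of_continuousAt_fderiv μ hU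
    (fun q e he ↦ (hderiv q e he).differentiableAt) (fun e he ↦ ?_) (fun q e he ↦ ?_) he
  · exact hT.clm_apply (continuous_iff_continuousAt.2 fun q ↦
      ContinuousAt.comp (f := fun q ↦ (q, e))
        (continuousAt_apply_of_contMDiffAt_uncurry hj (hf q e he)) (by fun_prop))
  · have hcont : ContinuousAt (fun z : X × E ↦ (T z.1).comp (fderiv ℝ (f (j z.1)) z.2)) (q, e) :=
      (hT.comp continuous_fst).continuousAt.clm_comp
        (continuousAt_apply_of_contMDiffAt_uncurry hj (contMDiffAt_uncurry_fderiv (hf q e he)))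
    refine hcont.congr ?_
    filter_upwards [continuous_snd.continuousAt.preimage_mem_nhds (hU.mem_nhds he)] with z hz
    exact (hderiv z.1 z.2 hz).fderiv.symm

theorem contDiffOn_integral_clm_apply (hj : Continuous j) (hU : IsOpen U) (n : ℕ) :
    ∀ {F F' : Type u} [NormedAddCommGroup F] [NormedSpace ℝ F] [NormedAddCommGroup F']
      [NormedSpace ℝ F'] {T : X → F →L[ℝ] F'} {f : P → E → F}, Continuous T →
      (∀ q, ∀ e ∈ U,
        ContMDiffAt (𝓘(ℝ, E').prod 𝓘(ℝ, E)) 𝓘(ℝ, F) ∞ (Function.uncurry f) (j q, e)) →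
      ContDiffOn ℝ n (fun e ↦ ∫ q, T q (f (j q) e) ∂μ) U := by
  induction n with
  | zero =>
    intro F F' _ _ _ _ T f hT hf
    exact contDiffOn_zero.2 fun e he ↦
      (hasFDerivAt_integral_clm_apply μ hj hU hT hf he).continuousAt.continuousWithinAt
  | succ n ih =>
    intro F F' _ _ _ _ T f hT hf
    have hderiv := fun e (he : e ∈ U) ↦ hasFDerivAt_integral_clm_apply μ hj hU hT hf he
    push_cast
    refine (contDiffOn_succ_iff_fderiv_of_isOpen hU).2
      ⟨fun e he ↦ (hderiv e he).differentiableAt.differentiableWithinAt, by simp, ?_⟩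
    exact (ih ((ContinuousLinearMap.compL ℝ E F F').continuous.comp hT)
      fun q e he ↦ contMDiffAt_uncurry_fderiv (hf q e he)).congr fun e he ↦ (hderiv e he).fderiv

end ParametricIntegral

section IsotropyRepresentation

theorem compactSpace_stabilizer (K : Type*) {M : Type*} [TopologicalSpace K] [Group K]
    [TopologicalSpace M] [MulAction K M] [ContinuousSMul K M] [CompactSpace K] [T1Space M]
    (x : M) : CompactSpace (MulAction.stabilizer K x) :=
  isCompact_iff_compactSpace.1
    ((isClosed_singleton (x := x)).preimage (continuous_id.smul continuous_const)).isCompact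

theorem eventually_forall_smul_of_mem_stabilizer {K M : Type*} [TopologicalSpace K] [Group K]
    [TopologicalSpace M] [MulAction K M] [ContinuousSMul K M]
    {x : M} [CompactSpace (MulAction.stabilizer K x)] {Q : M → Prop} (hQ : ∀ᶠ y in 𝓝 x, Q y) :
    ∀ᶠ y in 𝓝 x, ∀ h ∈ MulAction.stabilizer K x, Q (h • y) := by
  refine (isCompact_iff_compactSpace.2 ‹_›).eventually_forall_of_forall_eventually
    (K := (MulAction.stabilizer K x : Set K)) (P := fun y h ↦ Q (h • y)) fun h hh ↦ ?_
  have hsmul : Tendsto (fun z : M × K ↦ z.2 • z.1) (𝓝 (x, h)) (𝓝 (h • x)) :=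
    (continuous_snd.smul continuous_fst).tendsto (x, h)
  rw [MulAction.mem_stabilizer_iff.1 hh] at hsmul
  exact hsmul.eventually hQ

variable {EK EM : Type*} [NormedAddCommGroup EK] [NormedSpace ℝ EK]
  [NormedAddCommGroup EM] [NormedSpace ℝ EM]
  {K : Type*} [Group K]
  {M : Type*} [TopologicalSpace M] [ChartedSpace EM M] [MulAction K M]

variable (EM) in
/-- The isotropy representation of `K_x` on the tangent space at `x`. It is defined for all
elements of `K`, but only its values on the stabilizer of `x` are meaningful. -/
noncomputable def isotropyRep (x : M) (h : K) : EM →L[ℝ] EM :=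
  mderiv EM EM (fun y : M ↦ h • y) x

theorem isotropyRep_one (x : M) : isotropyRep EM x (1 : K) = .id ℝ EM := by
  simpa only [isotropyRep, one_smul] using mderiv_id x

variable (EK) [TopologicalSpace K] [ChartedSpace EK K] [ContMDiffSMul 𝓘(ℝ, EK) 𝓘(ℝ, EM) ∞ K M]

include EK in
theorem isotropyRep_mul {x : M} (h : K) {k : K} (hk : k ∈ MulAction.stabilizer K x) :
    isotropyRep EM x (h * k) = (isotropyRep EM x h).comp (isotropyRep EM x k) := by
  have hcomp := mderiv_comp (smoothNear_const_smul (EM := EM) EK h x)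
    (smoothNear_const_smul (EM := EM) EK k x) (MulAction.mem_stabilizer_iff.1 hk)
  simpa only [isotropyRep, mul_smul] using hcomp

include EK in
theorem isotropyRep_comp_inv {x : M} {h : K} (hh : h ∈ MulAction.stabilizer K x) :
    (isotropyRep EM x h).comp (isotropyRep EM x h⁻¹) = .id ℝ EM := by
  rw [← isotropyRep_mul EK h (inv_mem hh), mul_inv_cancel, isotropyRep_one]

include EK in
theorem continuous_isotropyRep [IsManifold 𝓘(ℝ, EM) ∞ M] [IsManifold 𝓘(ℝ, EK) ∞ K] (x : M) :
    Continuous fun h : MulAction.stabilizer K x ↦ isotropyRep EM x (h : K) := by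
  have hsmul : ContMDiff (𝓘(ℝ, EK).prod 𝓘(ℝ, EM)) 𝓘(ℝ, EM) ∞
      (Function.uncurry fun (k : K) (y : M) ↦ k • y) := contMDiff_fst.smul contMDiff_snd
  exact continuousOn_iff_continuous_domRestrict.1 (continuousOn_mderiv_of_apply_eq hsmul x x)

end IsotropyRepresentation

section Linearization

theorem exists_invariant_probabilityMeasure (H : Type*) [Group H] [TopologicalSpace H]
    [IsTopologicalGroup H] [CompactSpace H] [MeasurableSpace H] [BorelSpace H] :
    ∃ μ : Measure H, IsProbabilityMeasure μ ∧ μ.IsMulLeftInvariant :=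
  ⟨Measure.haarMeasure ⊤, ⟨Measure.haarMeasure_self (K₀ := ⊤)⟩, inferInstance⟩

universe u

variable {EK : Type*} [NormedAddCommGroup EK] [NormedSpace ℝ EK]
  {EM : Type u} [NormedAddCommGroup EM] [NormedSpace ℝ EM]
  {K : Type*} [TopologicalSpace K] [ChartedSpace EK K] [Group K]
  {M : Type*} [TopologicalSpace M] [ChartedSpace EM M] [MulAction K M]
  {x : M} [MeasurableSpace (MulAction.stabilizer K x)] (μ : Measure (MulAction.stabilizer K x))

/-- The average of the chart `ψ` centered at `x` over the isotropy subgroup of `x`, which acts on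
`M` and, through the isotropy representation, on the tangent space at `x`. -/
noncomputable def averagedChart (ψ : M → EM) (y : M) : EM :=
  ∫ h : MulAction.stabilizer K x, isotropyRep EM x (h : K) (ψ ((h : K)⁻¹ • y)) ∂μ

variable (EK) [BorelSpace (MulAction.stabilizer K x)] [CompactSpace (MulAction.stabilizer K x)]
  [LieGroup 𝓘(ℝ, EK) ∞ K] [IsManifold 𝓘(ℝ, EM) ∞ M] [ContMDiffSMul 𝓘(ℝ, EK) 𝓘(ℝ, EM) ∞ K M]

include EK

theorem averagedChart_smul [CompleteSpace EM] [IsFiniteMeasure μ] [μ.IsMulLeftInvariant]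
    {ψ : M → EM} {y : M} (hψ : ∀ h ∈ MulAction.stabilizer K x, SmoothNear EM EM ψ (h • y))
    {k : K} (hk : k ∈ MulAction.stabilizer K x) :
    averagedChart μ ψ (k • y) = isotropyRep EM x k (averagedChart μ ψ y) := by
  have := ContMDiffSMul.continuousSMul (I := 𝓘(ℝ, EK)) (I' := 𝓘(ℝ, EM)) (G := K) (M := M) ∞
  have := topologicalGroup_of_lieGroup 𝓘(ℝ, EK) ∞ (G := K)
  have hcont : Continuous fun h : MulAction.stabilizer K x ↦
      isotropyRep EM x (h : K) (ψ ((h : K)⁻¹ • y)) := by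
    refine (continuous_isotropyRep EK x).clm_apply (continuous_iff_continuousAt.2 fun h ↦ ?_)
    exact ContinuousAt.comp (f := fun h : MulAction.stabilizer K x ↦ (h : K)⁻¹ • y)
      (hψ _ (inv_mem h.2)).continuousAt (by fun_prop)
  rw [averagedChart, averagedChart, ← ContinuousLinearMap.integral_comp_comm _
    (hcont.integrable_of_hasCompactSupport (.of_compactSpace _)),
    ← integral_mul_left_eq_self _ (⟨k, hk⟩ : MulAction.stabilizer K x)]
  refine integral_congr_ae (ae_of_all _ fun h ↦ ?_)
  simp only [Subgroup.coe_mul, mul_inv_rev, smul_smul, inv_mul_cancel_right,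
    isotropyRep_mul EK k h.2, ContinuousLinearMap.comp_apply]

omit [MeasurableSpace (MulAction.stabilizer K x)] [BorelSpace (MulAction.stabilizer K x)]
  [IsManifold 𝓘(ℝ, EM) ∞ M] in
theorem exists_isOpen_contMDiffAt_chart_smul {φ : EM → M} {ψ : M → EM}
    (hφ : SmoothNear EM EM φ 0) (hφ0 : φ 0 = x) (hψ : SmoothNear EM EM ψ x) :
    ∃ U : Set EM, IsOpen U ∧ 0 ∈ U ∧ ∀ h : MulAction.stabilizer K x, ∀ e ∈ U,
      ContMDiffAt (𝓘(ℝ, EK).prod 𝓘(ℝ, EM)) 𝓘(ℝ, EM) ∞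
        (Function.uncurry fun (k : K) (e : EM) ↦ ψ (k⁻¹ • φ e)) ((h : K), e) := by
  have := ContMDiffSMul.continuousSMul (I := 𝓘(ℝ, EK)) (I' := 𝓘(ℝ, EM)) (G := K) (M := M) ∞
  obtain ⟨U, hU, hUo, hU0⟩ := eventually_nhds_iff.1 (hφ.and ((hφ.tendsto hφ0).eventually
    (eventually_forall_smul_of_mem_stabilizer (K := K) hψ)))
  refine ⟨U, hUo, hU0, fun h e he ↦ ?_⟩
  exact ContMDiffAt.comp (f := fun z : K × EM ↦ z.1⁻¹ • φ z.2) ((h : K), e)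
    ((hU e he).2 (h : K)⁻¹ (inv_mem h.2)) (contMDiffAt_fst.inv.smul
      (ContMDiffAt.comp (f := Prod.snd) ((h : K), e) (hU e he).1 contMDiffAt_snd))

theorem smoothNear_averagedChart [IsFiniteMeasure μ] {ψ : M → EM}
    (hψ : SmoothNear EM EM ψ x) : SmoothNear EM EM (averagedChart μ ψ) x := by
  obtain ⟨φ, χ, hφ, hχ, hφ0, hχx, -, -, -, hφχ⟩ := exists_centered_chart EM x
  obtain ⟨U, hUo, hU0, hU⟩ := exists_isOpen_contMDiffAt_chart_smul (K := K) EK hφ hφ0 hψ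
  have hsmooth : SmoothNear EM EM (fun e ↦ averagedChart μ ψ (φ e)) 0 := by
    refine smoothNear_iff_contDiffAt.2 (eventually_of_mem (hUo.mem_nhds hU0) fun e he ↦ ?_)
    exact (contDiffOn_infty.2 fun n ↦ contDiffOn_integral_clm_apply μ continuous_subtype_val hUo n
      (continuous_isotropyRep EK x) hU).contDiffAt (hUo.mem_nhds he)
  exact (hsmooth.comp_of_eq hχ hχx).congr (hφχ.mono fun y hy ↦ by simp only [hy])

theorem mderiv_averagedChart [CompleteSpace EM] [IsProbabilityMeasure μ] {ψ : M → EM}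
    (hψ : SmoothNear EM EM ψ x) (hDψ : mderiv EM EM ψ x = .id ℝ EM) :
    mderiv EM EM (averagedChart μ ψ) x = .id ℝ EM := by
  obtain ⟨φ, -, hφ, -, hφ0, -, hDφ, -, -, -⟩ := exists_centered_chart EM x
  obtain ⟨U, hUo, hU0, hU⟩ := exists_isOpen_contMDiffAt_chart_smul (K := K) EK hφ hφ0 hψ
  have hderiv (h : MulAction.stabilizer K x) :
      (isotropyRep EM x (h : K)).comp (fderiv ℝ (fun e ↦ ψ ((h : K)⁻¹ • φ e)) 0) =
        .id ℝ EM := by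
    have hx : (h : K)⁻¹ • x = x := inv_mem h.2
    rw [← mderiv_eq_fderiv, mderiv_comp hψ ((smoothNear_const_smul EK (h : K)⁻¹ x).comp_of_eq
      hφ hφ0) (by rw [hφ0, hx]), mderiv_comp (smoothNear_const_smul EK (h : K)⁻¹ x) hφ hφ0, hDψ,
      hDφ]
    exact isotropyRep_comp_inv EK h.2
  have hint := hasFDerivAt_integral_clm_apply μ continuous_subtype_val hUo
    (continuous_isotropyRep EK x) hU hU0
  simp only [hderiv, integral_const, probReal_univ, one_smul] at hint
  calc mderiv EM EM (averagedChart μ ψ) x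
      = mderiv EM EM (fun e ↦ averagedChart μ ψ (φ e)) 0 := by
        rw [mderiv_comp (smoothNear_averagedChart EK μ hψ) hφ hφ0, hDφ,
          ContinuousLinearMap.comp_id]
    _ = .id ℝ EM := (mderiv_eq_fderiv _ _).trans hint.fderiv

variable (EM K) in
omit [MeasurableSpace (MulAction.stabilizer K x)] [BorelSpace (MulAction.stabilizer K x)]
  [CompactSpace (MulAction.stabilizer K x)] in
theorem exists_equivariant_chart [CompleteSpace EM] (x : M)
    [CompactSpace (MulAction.stabilizer K x)] :
    ∃ σ : EM → M, SmoothNear EM EM σ 0 ∧ σ 0 = x ∧ mderiv EM EM σ 0 = .id ℝ EM ∧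
      ∀ᶠ n in 𝓝 (0 : EM), ∀ h ∈ MulAction.stabilizer K x, σ (isotropyRep EM x h n) = h • σ n := by
  have := ContMDiffSMul.continuousSMul (I := 𝓘(ℝ, EK)) (I' := 𝓘(ℝ, EM)) (G := K) (M := M) ∞
  have := topologicalGroup_of_lieGroup 𝓘(ℝ, EK) ∞ (G := K)
  borelize ↥(MulAction.stabilizer K x)
  obtain ⟨μ, _, _⟩ := exists_invariant_probabilityMeasure (MulAction.stabilizer K x)
  obtain ⟨-, ψ, -, hψ, -, hψx, -, hDψ, -, -⟩ := exists_centered_chart EM x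
  set L := averagedChart μ ψ with hL
  have hLs : SmoothNear EM EM L x := smoothNear_averagedChart EK μ hψ
  have hDL : mderiv EM EM L x = .id ℝ EM := mderiv_averagedChart EK μ hψ hDψ
  have hLx : L x = 0 := by
    have hinv (h : MulAction.stabilizer K x) : (h : K)⁻¹ • x = x := inv_mem h.2
    simp only [hL, averagedChart, hinv, hψx, map_zero, integral_zero]
  obtain ⟨σ, hσx, hσ, hσL, hLσ⟩ := exists_smooth_local_inverse hLs
    (hDL ▸ ⟨.refl ℝ EM, rfl⟩)
  rw [hLx] at hσx hσ hLσ
  refine ⟨σ, hσ, hσx, ?_, ?_⟩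
  · simpa only [hDL, ContinuousLinearMap.comp_id] using mderiv_comp_mderiv_eq_id hσ hLs hLx hσL
  filter_upwards [hLσ, (hσ.tendsto hσx).eventually
    (eventually_forall_smul_of_mem_stabilizer (K := K) (hψ.eventually.and hσL))] with n hn hnK h hh
  have hLn := averagedChart_smul EK μ (fun k hk ↦ (hnK k hk).1) hh
  rw [← hL, hn] at hLn
  rw [← hLn, (hnK h hh).2]

end Linearization

section InvariantForm

variable {H : Type*} [Group H] {E : Type*} [NormedAddCommGroup E] [NormedSpace ℝ E]

/-- The bilinear form `B` is an inner product for which the representation `ρ` is orthogonal. -/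
structure IsInvariantInner (B : LinearMap.BilinForm ℝ E) (ρ : H →* (E →L[ℝ] E)) : Prop where
  isSymm : B.IsSymm
  pos : ∀ v, v ≠ 0 → 0 < B v v
  invariant : ∀ h u v, B (ρ h u) (ρ h v) = B u v

variable {ρ : H →* (E →L[ℝ] E)}

theorem map_mul_apply (ρ : H →* (E →L[ℝ] E)) (h k : H) (v : E) : ρ (h * k) v = ρ h (ρ k v) := by
  rw [map_mul]
  rfl

theorem apply_inv_apply (ρ : H →* (E →L[ℝ] E)) (h : H) (v : E) : ρ h (ρ h⁻¹ v) = v := by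
  rw [← map_mul_apply, mul_inv_cancel, map_one]
  rfl

variable [TopologicalSpace H] [CompactSpace H]

theorem exists_isInvariantInner [IsTopologicalGroup H] [FiniteDimensional ℝ E]
    (hρ : Continuous ρ) : ∃ B : LinearMap.BilinForm ℝ E, IsInvariantInner B ρ := by
  borelize H
  obtain ⟨μ, _, _⟩ := exists_invariant_probabilityMeasure H
  let T : E ≃L[ℝ] EuclideanSpace ℝ (Fin (Module.finrank ℝ E)) := toEuclidean
  let b (h : H) : E →L[ℝ] E →L[ℝ] ℝ :=
    (innerSL ℝ).bilinearComp (T.toContinuousLinearMap.comp (ρ h⁻¹))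
      (T.toContinuousLinearMap.comp (ρ h⁻¹))
  have hTρ (v : E) : Continuous fun h ↦ T (ρ h⁻¹ v) :=
    T.continuous.comp ((hρ.comp continuous_inv).clm_apply continuous_const)
  have hb : Continuous b := continuous_clm_apply.2 fun u ↦ continuous_clm_apply.2 fun v ↦
    (hTρ u).inner (hTρ v)
  have hint (u v : E) : (∫ h, b h ∂μ) u v = ∫ h, inner ℝ (T (ρ h⁻¹ u)) (T (ρ h⁻¹ v)) ∂μ := by
    rw [ContinuousLinearMap.integral_apply
        (hb.integrable_of_hasCompactSupport (.of_compactSpace _)),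
      ContinuousLinearMap.integral_apply
        ((hb.clm_apply continuous_const).integrable_of_hasCompactSupport (.of_compactSpace _))]
    rfl
  refine ⟨(∫ h, b h ∂μ).toBilinForm, ⟨fun u v ↦ ?_⟩, fun v hv ↦ ?_, fun k u v ↦ ?_⟩
  · exact (hint u v).trans (((hint v u).trans
      (integral_congr_ae (ae_of_all _ fun h ↦ real_inner_comm _ _))).symm)
  · refine (hint v v).symm ▸ (integral_pos_iff_support_of_nonneg
      (fun h ↦ real_inner_self_nonneg)
      (((hTρ v).inner (hTρ v)).integrable_of_hasCompactSupport (.of_compactSpace _))).2 ?_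
    have hsupp : Function.support (fun h ↦ inner ℝ (T (ρ h⁻¹ v)) (T (ρ h⁻¹ v))) = univ := by
      refine eq_univ_of_forall fun h ↦ inner_self_ne_zero.2 fun h0 ↦ hv ?_
      rw [← apply_inv_apply ρ h v, T.map_eq_zero_iff.1 h0, map_zero]
    rw [hsupp, measure_univ]
    exact zero_lt_one
  · refine (hint _ _).trans (Eq.trans ?_ (hint u v).symm)
    rw [← integral_mul_left_eq_self _ k]
    have hcancel (h : H) (w : E) : ρ (k * h)⁻¹ (ρ k w) = ρ h⁻¹ w := by
      rw [← map_mul_apply, mul_inv_rev, inv_mul_cancel_right]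
    simp only [hcancel]

omit [TopologicalSpace H] [CompactSpace H] in
theorem IsInvariantInner.exists_isCompl [FiniteDimensional ℝ E] {B : LinearMap.BilinForm ℝ E}
    (hB : IsInvariantInner B ρ) {R : Submodule ℝ E} (hR : ∀ h, ∀ r ∈ R, ρ h r ∈ R) :
    ∃ N : Submodule ℝ E, IsCompl R N ∧ ∀ h, ∀ n ∈ N, ρ h n ∈ N := by
  refine ⟨B.orthogonal R, ?_, fun h n hn ↦ LinearMap.BilinForm.mem_orthogonal_iff.2 fun r hr ↦ ?_⟩
  · rw [LinearMap.BilinForm.isCompl_orthogonal_iff_disjoint hB.isSymm.isRefl,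
      Submodule.disjoint_def]
    intro v hv hvR
    by_contra hne
    exact (hB.pos v hne).ne' (LinearMap.BilinForm.mem_orthogonal_iff.1 hvR v hv)
  · rw [← apply_inv_apply ρ h r]
    exact (hB.invariant h _ n).trans
      (LinearMap.BilinForm.mem_orthogonal_iff.1 hn _ (hR h⁻¹ r hr))

omit [CompactSpace H] [TopologicalSpace H] in
/-- If `w` maximizes `B v` over its orbit, it is a nearest point to `v` in that orbit. -/
theorem IsInvariantInner.eq_of_fixes_segment {B : LinearMap.BilinForm ℝ E}
    (hB : IsInvariantInner B ρ) {v w : E} {h : H} (hmax : B v (ρ h w) ≤ B v w) {t : ℝ}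
    (h0 : 0 < t) (h1 : t < 1) (hfix : ρ h ((1 - t) • v + t • w) = (1 - t) • v + t • w) :
    ρ h v = v ∧ ρ h w = w := by
  have hdist : B (v - ρ h v) (v - ρ h v) = 2 * (B v v - B v (ρ h v)) := by
    simp only [map_sub, LinearMap.sub_apply, hB.invariant, hB.isSymm.eq (ρ h v) v]
    ring
  have hfixB := congrArg (B v) hfix
  simp only [map_add, map_smul, smul_eq_mul] at hfixB
  have hle : B (v - ρ h v) (v - ρ h v) ≤ 0 := by
    rw [hdist]
    nlinarith [mul_nonneg h0.le (sub_nonneg.2 hmax)]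
  have hv : ρ h v = v := by
    by_contra hne
    exact (hB.pos _ (sub_ne_zero.2 (Ne.symm hne))).not_ge hle
  refine ⟨hv, smul_right_injective E h0.ne' ?_⟩
  simpa only [map_add, map_smul, hv, add_right_inj] using hfix

theorem eventually_forall_apply (hρ : Continuous ρ) {P : E → Prop} (hP : ∀ᶠ n in 𝓝 0, P n) :
    ∀ᶠ n in 𝓝 (0 : E), ∀ h, P (ρ h n) := by
  have hcont : Continuous fun z : E × H ↦ ρ z.2 z.1 :=
    (hρ.comp continuous_snd).clm_apply continuous_fst
  have hev := isCompact_univ.eventually_forall_of_forall_eventually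
    (P := fun n h ↦ P (ρ h n)) fun h _ ↦ (hcont.tendsto' (0, h) 0 (map_zero _)).eventually hP
  simpa only [mem_univ, true_imp_iff] using hev

theorem exists_convex_invariant_nhds (hρ : Continuous ρ) {P : E → Prop}
    (hP : ∀ᶠ n in 𝓝 0, P n) : ∃ O ∈ 𝓝 (0 : E), Convex ℝ O ∧ (∀ h, ∀ n ∈ O, ρ h n ∈ O) ∧
      ∀ n ∈ O, P n := by
  obtain ⟨r, hr, hball⟩ := Metric.eventually_nhds_iff_ball.1 hP
  refine ⟨{n | ∀ h, ρ h n ∈ Metric.ball 0 r}, ?_, fun u hu v hv a b ha hb hab h ↦ ?_,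
    fun h n hn k ↦ ?_, fun n hn ↦ hball n ?_⟩
  · exact eventually_forall_apply hρ (Metric.ball_mem_nhds 0 hr)
  · rw [map_add, map_smul, map_smul]
    exact convex_ball 0 r (hu h) (hv h) ha hb hab
  · rw [← map_mul_apply]
    exact hn (k * h)
  · have hn1 := hn 1
    rwa [map_one] at hn1

theorem exists_forall_apply_le (hρ : Continuous ρ) [FiniteDimensional ℝ E] (ℓ : E →ₗ[ℝ] ℝ)
    (w : E) : ∃ h₀, ∀ h, ℓ (ρ h (ρ h₀ w)) ≤ ℓ (ρ h₀ w) := by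
  have hcont : Continuous fun h ↦ ℓ (ρ h w) :=
    ℓ.continuous_of_finiteDimensional.comp (hρ.clm_apply continuous_const)
  obtain ⟨h₀, -, hmax⟩ := isCompact_univ.exists_isMaxOn univ_nonempty hcont.continuousOn
  refine ⟨h₀, fun h ↦ ?_⟩
  rw [← map_mul_apply]
  exact hmax (mem_univ (h * h₀))

end InvariantForm

section Slice

theorem eventually_exists_mem_stabilizer_of_smul_eq {K M : Type*} [TopologicalSpace K] [Group K]
    [ContinuousMul K] [CompactSpace K] [TopologicalSpace M] [T2Space M] [MulAction K M]
    [ContinuousSMul K M] (x : M) {Q : K → Prop} (hQ : ∀ᶠ k in 𝓝 1, Q k) :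
    ∀ᶠ y in 𝓝 x, ∀ k : K, k • y = y → ∃ h ∈ MulAction.stabilizer K x, Q (h⁻¹ * k) := by
  have hev := isCompact_univ.eventually_forall_of_forall_eventually (x₀ := x)
    (P := fun y (k : K) ↦ k • y = y → ∃ h ∈ MulAction.stabilizer K x, Q (h⁻¹ * k)) fun k _ ↦ ?_
  · simpa only [mem_univ, true_imp_iff] using hev
  by_cases hk : k • x = x
  · have hmul : Tendsto (fun z : M × K ↦ k⁻¹ * z.2) (𝓝 (x, k)) (𝓝 1) :=
      (continuous_const.mul continuous_snd).tendsto' _ _ (inv_mul_cancel k)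
    exact (hmul.eventually hQ).mono fun z hz _ ↦ ⟨k, hk, hz⟩
  · have hmove : IsClosed {z : M × K | z.2 • z.1 = z.1} := isClosed_eq (by fun_prop) (by fun_prop)
    filter_upwards [hmove.isOpen_compl.mem_nhds hk] with z hz hz' using absurd hz' hz

variable {EK EM V : Type*} [NormedAddCommGroup EK] [NormedSpace ℝ EK]
  [NormedAddCommGroup EM] [NormedSpace ℝ EM] [NormedAddCommGroup V] [NormedSpace ℝ V]
  {K : Type*} [TopologicalSpace K] [Group K]
  {M : Type*} [TopologicalSpace M] [MulAction K M] {x : M}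

/-- A linear slice at `x`: a representation `ρ` of `K_x` on `V` and a parametrization `σ`, over an
invariant convex subset `O` of `V`, of a subset of `M` transverse to the orbit of `x`. The last
field says that an element of `K` fixing a point of the slice does so through `ρ`. -/
structure IsSlice (ρ : MulAction.stabilizer K x →* (V →L[ℝ] V)) (O : Set V) (σ : V → M) :
    Prop where
  continuous_rep : Continuous ρ
  convex : Convex ℝ O
  continuousOn : ContinuousOn σ O
  rep_mem : ∀ h, ∀ n ∈ O, ρ h n ∈ O
  map_rep : ∀ h, ∀ n ∈ O, σ (ρ h n) = h • σ n
  rep_eq_of_smul_eq : ∀ n ∈ O, ∀ k : K, k • σ n = σ n →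
    ∃ hk : k ∈ MulAction.stabilizer K x, ρ ⟨k, hk⟩ n = n

variable [ChartedSpace EK K] [ChartedSpace EM M]

theorem IsTube.eventually_c_smul_eq [FiniteDimensional ℝ EK] [LieGroup 𝓘(ℝ, EK) ∞ K]
    [ContMDiffSMul 𝓘(ℝ, EK) 𝓘(ℝ, EM) ∞ K M] {σ : V → M} {c : M → K} {s : M → V}
    (h : IsTube EK EM σ x c s) (hσx : σ 0 = x) : ∀ᶠ k in 𝓝 (1 : K), c (k • x) • x = k • x := by
  have horb := smoothNear_smul_const (EA := EK) (EM := EM) x (1 : K)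
  have hs : ∀ᶠ k in 𝓝 (1 : K), s (k • x) = 0 :=
    h.eventually_s_eq_zero horb (one_smul K x)
      (Eventually.of_forall fun k ↦ range_mderiv_smul_const_le (smoothNear_id k) x)
      (Eventually.of_forall fun k ↦ (finrank_range_infAction_smul k x).le)
  filter_upwards [hs, (horb.tendsto (one_smul K x)).eventually h.c_smul_s] with k hsk hck
  rwa [hsk, hσx] at hck

theorem IsTube.eventually_rep_eq_of_smul_eq [ContinuousMul K] [CompactSpace K] [T2Space M]
    [ContinuousSMul K M] {ρ : MulAction.stabilizer K x →* (V →L[ℝ] V)} {σ : V → M} {c : M → K}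
    {s : M → V} (htube : IsTube EK EM σ x c s)
    [CompactSpace (MulAction.stabilizer K x)] (hρ : Continuous ρ) (hσ : ContinuousAt σ 0)
    (hσx : σ 0 = x) (hc : ∀ᶠ k in 𝓝 (1 : K), c (k • x) • x = k • x)
    (hσρ : ∀ᶠ n in 𝓝 (0 : V), ∀ h : MulAction.stabilizer K x, σ (ρ h n) = h • σ n) :
    ∀ᶠ n in 𝓝 (0 : V), ∀ k : K, k • σ n = σ n →
      ∃ hk : k ∈ MulAction.stabilizer K x, ρ ⟨k, hk⟩ n = n := by
  have hcs := htube.c_s_smul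
  rw [nhds_prod_eq] at hcs
  obtain ⟨P, hP, Q, hQ, hcs⟩ := eventually_prod_iff.1 hcs
  have hkx : Tendsto (fun k : K ↦ k • x) (𝓝 1) (𝓝 x) :=
    (continuous_id.smul continuous_const).tendsto' 1 x (one_smul K x)
  have hmove := eventually_exists_mem_stabilizer_of_smul_eq x (hc.and (hkx.eventually hP))
  filter_upwards [(hσx ▸ hσ.tendsto : Tendsto σ (𝓝 0) (𝓝 x)).eventually hmove,
    eventually_forall_apply hρ hQ, hσρ] with n hfix hQn hσn k hk
  obtain ⟨h, hh, hck, hPk⟩ := hfix k hk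
  set c₁ := c ((h⁻¹ * k) • x)
  have hslice (m : MulAction.stabilizer K x) : c (σ (ρ m n)) = 1 ∧ s (σ (ρ m n)) = ρ m n := by
    simpa only [htube.c_self, one_smul] using hcs hP.self_of_nhds (hQn m)
  have hm : c₁⁻¹ * (h⁻¹ * k) ∈ MulAction.stabilizer K x := by
    rw [MulAction.mem_stabilizer_iff, mul_smul, inv_smul_eq_iff, hck]
  have hσm : c₁ • σ (ρ ⟨_, hm⟩ n) = σ (ρ ⟨h, hh⟩⁻¹ n) := by
    rw [hσn, hσn, Subgroup.mk_smul, Subgroup.smul_def, smul_smul, mul_inv_cancel_left, mul_smul,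
      hk]
    rfl
  have hc₁ : c₁ = 1 := calc
    c₁ = c (c₁ • σ (ρ ⟨_, hm⟩ n)) := (hcs hPk (hQn _)).1.symm
    _ = 1 := by rw [hσm, (hslice _).1]
  have hkK : k ∈ MulAction.stabilizer K x := by
    rw [hc₁, inv_one, one_mul] at hm
    simpa only [mul_inv_cancel_left] using mul_mem hh hm
  refine ⟨hkK, ?_⟩
  have hone := (hslice 1).2
  rw [map_one] at hone
  rw [← (hslice ⟨k, hkK⟩).2, hσn, Subgroup.mk_smul, hk]
  exact hone

end Slice

section Representation

variable {H E : Type*} [Group H] [NormedAddCommGroup E] [NormedSpace ℝ E]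
  {ρ : H →* (E →L[ℝ] E)} {N : Submodule ℝ E} (hN : ∀ h, ∀ n ∈ N, ρ h n ∈ N)

/-- The subrepresentation of `ρ` on an invariant subspace `N`, with values in continuous maps. -/
def restrictRep : H →* (N →L[ℝ] N) where
  toFun h := (ρ h).restrict (hN h)
  map_one' := by
    ext n
    exact DFunLike.congr_fun (map_one ρ) (n : E)
  map_mul' h k := by
    ext n
    exact map_mul_apply ρ h k n

theorem continuous_restrictRep [TopologicalSpace H] [FiniteDimensional ℝ E] (hρ : Continuous ρ) :
    Continuous (restrictRep hN) :=
  continuous_clm_apply.2 fun _ ↦ (hρ.clm_apply continuous_const).subtype_mk _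

end Representation

section SliceTheorem

universe u

variable {EK : Type*} [NormedAddCommGroup EK] [NormedSpace ℝ EK]
  {EM : Type u} [NormedAddCommGroup EM] [NormedSpace ℝ EM]
  {K : Type*} [TopologicalSpace K] [ChartedSpace EK K] [Group K]
  {M : Type*} [TopologicalSpace M] [ChartedSpace EM M] [MulAction K M]
  [ContMDiffSMul 𝓘(ℝ, EK) 𝓘(ℝ, EM) ∞ K M]

variable (EK EM) in
/-- The isotropy representation as a homomorphism on the stabilizer. -/
noncomputable def isotropyHom (x : M) : MulAction.stabilizer K x →* (EM →L[ℝ] EM) where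
  toFun h := isotropyRep EM x (h : K)
  map_one' := isotropyRep_one x
  map_mul' h k := isotropyRep_mul EK (h : K) k.2

variable [LieGroup 𝓘(ℝ, EK) ∞ K]

theorem isotropyHom_apply_mem_range (x : M) (h : MulAction.stabilizer K x) {v : EM}
    (hv : v ∈ (infAction EK EM K x).range) :
    isotropyHom EK EM x h v ∈ (infAction EK EM K x).range := by
  obtain ⟨u, rfl⟩ := hv
  have hAd := infAction_smul_comp_Ad (EA := EK) (EM := EM) (h : K) x
  rw [MulAction.mem_stabilizer_iff.1 h.2] at hAd
  exact ⟨Ad EK (h : K) u, DFunLike.congr_fun hAd u⟩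

variable [FiniteDimensional ℝ EK] [FiniteDimensional ℝ EM] [IsManifold 𝓘(ℝ, EM) ∞ M]

variable (EK EM K) in
theorem exists_equivariant_tube (x : M) [CompactSpace (MulAction.stabilizer K x)] :
    ∃ (N : Submodule ℝ EM) (ρ : MulAction.stabilizer K x →* (N →L[ℝ] N)) (σ : N → M)
      (c : M → K) (s : M → N), Continuous ρ ∧ SmoothNear N EM σ 0 ∧ σ 0 = x ∧
        IsTube EK EM σ x c s ∧
        ∀ᶠ n in 𝓝 (0 : N), ∀ h : MulAction.stabilizer K x, σ (ρ h n) = h • σ n := by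
  have := topologicalGroup_of_lieGroup 𝓘(ℝ, EK) ∞ (G := K)
  obtain ⟨φ, hφ, hφx, hDφ, hequiv⟩ := exists_equivariant_chart EK EM K x
  have hiso : Continuous (isotropyHom EK EM (K := K) x) := continuous_isotropyRep EK x
  obtain ⟨B, hB⟩ := exists_isInvariantInner hiso
  obtain ⟨N, hN, hNinv⟩ := hB.exists_isCompl
    (R := (infAction EK EM K x).range) fun h v hv ↦ isotropyHom_apply_mem_range x h hv
  have hincl : SmoothNear N EM (fun n : N ↦ (n : EM)) 0 :=
    smoothNear_of_contMDiff N.subtypeL.contDiff.contMDiff _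
  have hσ : SmoothNear N EM (fun n : N ↦ φ n) 0 := hφ.comp_of_eq hincl rfl
  have hDσ : mderiv N EM (fun n : N ↦ φ n) 0 = N.subtypeL := by
    rw [mderiv_comp hφ hincl rfl, hDφ, ContinuousLinearMap.id_comp]
    exact (mderiv_eq_fderiv _ _).trans N.subtypeL.fderiv
  obtain ⟨c, s, htube⟩ := exists_isTube (A := K) (EA := EK) (σ := fun n : N ↦ φ n)
    hσ hφx (hDσ ▸ Subtype.val_injective) (by rw [hDσ]; exact N.range_subtype.symm ▸ hN)
  refine ⟨N, restrictRep hNinv, fun n ↦ φ n, c, s, continuous_restrictRep hNinv hiso, hσ, hφx,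
    htube, ?_⟩
  filter_upwards [(hincl.tendsto rfl).eventually hequiv] with n hn h using hn h h.2

variable (EK EM K) in
theorem exists_isSlice [CompactSpace K] [T2Space M] (x : M) :
    ∃ (N : Submodule ℝ EM) (ρ : MulAction.stabilizer K x →* (N →L[ℝ] N)) (O : Set N) (σ : N → M)
      (c : M → K), IsSlice ρ O σ ∧ SmoothNear EM EK c x ∧
        ∀ᶠ y in 𝓝 x, ∃ n ∈ O, c y • σ n = y := by
  have := ContMDiffSMul.continuousSMul (I := 𝓘(ℝ, EK)) (I' := 𝓘(ℝ, EM)) (G := K) (M := M) ∞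
  have := topologicalGroup_of_lieGroup 𝓘(ℝ, EK) ∞ (G := K)
  have := compactSpace_stabilizer K x
  obtain ⟨N, ρ, σ, c, s, hρ, hσ, hσx, htube, hσρ⟩ := exists_equivariant_tube EK EM K x
  have hstab := htube.eventually_rep_eq_of_smul_eq hρ hσ.continuousAt hσx
    (htube.eventually_c_smul_eq hσx) hσρ
  obtain ⟨O, hO, hOc, hOρ, hOP⟩ :=
    exists_convex_invariant_nhds hρ (hstab.and (hσρ.and hσ.eventually))
  refine ⟨N, ρ, O, σ, c, ⟨hρ, hOc, fun n hn ↦ ?_, hOρ, fun h n hn ↦ ?_, fun n hn ↦ ?_⟩,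
    htube.smoothNear_c, ?_⟩
  · exact (hOP n hn).2.2.continuousAt.continuousWithinAt
  · exact (hOP n hn).2.1 h
  · exact (hOP n hn).1
  · filter_upwards [htube.c_smul_s, (htube.smoothNear_s.tendsto htube.s_self).eventually_mem hO]
      with y hy hys using ⟨s y, hys, hy⟩

end SliceTheorem

section Conjugation

variable {K : Type*} [Group K]

theorem conjugate_conjugate (k l : K) (S : Subgroup K) :
    conjugate k (conjugate l S) = conjugate (k * l) S := by
  simp only [conjugate, Subgroup.map_map, map_mul]
  rfl

theorem conjugate_one (S : Subgroup K) : conjugate 1 S = S := by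
  simp only [conjugate, map_one]
  exact Subgroup.map_id S

variable {G M : Type*} [Group G] [MulAction K M] [MulAction G M] {ι : G →* K}

theorem stabilizer_eq_comap (hres : ∀ (g : G) (x : M), g • x = ι g • x) (x : M) :
    MulAction.stabilizer G x = (MulAction.stabilizer K x).comap ι := by
  ext g
  rw [MulAction.mem_stabilizer_iff, hres]
  rfl

theorem stabilizer_smul_eq_map (hres : ∀ (g : G) (x : M), g • x = ι g • x) {α : K → G ≃* G}
    (hα : ∀ k g, ι (α k g) = k * ι g * k⁻¹) (k : K) (y : M) :
    MulAction.stabilizer G (k • y) = (MulAction.stabilizer G y).map (α k).toMonoidHom := by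
  ext g
  rw [Subgroup.mem_map_equiv, MulAction.mem_stabilizer_iff, MulAction.mem_stabilizer_iff]
  have hg : ι g = k * ι ((α k).symm g) * k⁻¹ := by rw [← hα, MulEquiv.apply_symm_apply]
  rw [hres, hg, hres, mul_smul, mul_smul, inv_smul_smul, (MulAction.injective k).eq_iff]

end Conjugation

section Segment

variable {V : Type*} [NormedAddCommGroup V] [NormedSpace ℝ V] {K : Type*} [TopologicalSpace K]
  [Group K] {M : Type*} [TopologicalSpace M] [MulAction K M] {x : M}
  {ρ : MulAction.stabilizer K x →* (V →L[ℝ] V)} {O : Set V} {σ : V → M}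

theorem IsSlice.mem_stabilizer_iff (hσ : IsSlice ρ O σ) {n : V} (hn : n ∈ O) {k : K} :
    k ∈ MulAction.stabilizer K (σ n) ↔ ∃ hk : k ∈ MulAction.stabilizer K x, ρ ⟨k, hk⟩ n = n := by
  refine ⟨hσ.rep_eq_of_smul_eq n hn k, fun ⟨hk, hkn⟩ ↦ ?_⟩
  have hmap := hσ.map_rep ⟨k, hk⟩ n hn
  rw [hkn] at hmap
  exact hmap.symm

theorem IsSlice.stabilizer_le (hσ : IsSlice ρ O σ) {n : V} (hn : n ∈ O) :
    MulAction.stabilizer K (σ n) ≤ MulAction.stabilizer K x := fun _ hk ↦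
  ((hσ.mem_stabilizer_iff hn).1 hk).1

theorem IsSlice.stabilizer_segment (hσ : IsSlice ρ O σ) {B : LinearMap.BilinForm ℝ V}
    (hB : IsInvariantInner B ρ) {v w : V} (hv : v ∈ O) (hw : w ∈ O)
    (hmax : ∀ h, B v (ρ h w) ≤ B v w) {t : ℝ} (h0 : 0 < t) (h1 : t < 1) :
    MulAction.stabilizer K (σ ((1 - t) • v + t • w)) =
      MulAction.stabilizer K (σ v) ⊓ MulAction.stabilizer K (σ w) := by
  have ht : (1 - t) • v + t • w ∈ O :=
    hσ.convex hv hw (sub_nonneg.2 h1.le) h0.le (sub_add_cancel 1 t)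
  ext k
  rw [Subgroup.mem_inf, hσ.mem_stabilizer_iff ht, hσ.mem_stabilizer_iff hv,
    hσ.mem_stabilizer_iff hw]
  constructor
  · rintro ⟨hk, hfix⟩
    obtain ⟨hkv, hkw⟩ := hB.eq_of_fixes_segment (hmax _) h0 h1 hfix
    exact ⟨⟨hk, hkv⟩, hk, hkw⟩
  · rintro ⟨⟨hk, hkv⟩, _, hkw⟩
    exact ⟨hk, by rw [map_add, map_smul, map_smul, hkv, hkw]⟩

end Segment

section ConjIsotropy

variable {G : Type*} [TopologicalSpace G] [Group G] [IsTopologicalGroup G]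
  {K : Type*} [Group K] {M : Type*} [MulAction G M] {ι : G →* K} {x y z : M}

variable (ι x y) in
/-- The isotropy groups of `x` and `y` have identity components conjugate in `K`. -/
def ConjIsotropy : Prop :=
  ∃ k : K, (identityComponent (MulAction.stabilizer G x)).map ι =
    conjugate k ((identityComponent (MulAction.stabilizer G y)).map ι)

theorem ConjIsotropy.symm (h : ConjIsotropy ι x y) : ConjIsotropy ι y x := by
  obtain ⟨k, hk⟩ := h
  exact ⟨k⁻¹, by rw [hk, conjugate_conjugate, inv_mul_cancel, conjugate_one]⟩

theorem ConjIsotropy.trans (hxy : ConjIsotropy ι x y) (hyz : ConjIsotropy ι y z) :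
    ConjIsotropy ι x z := by
  obtain ⟨k, hk⟩ := hxy
  obtain ⟨l, hl⟩ := hyz
  exact ⟨k * l, by rw [hk, hl, conjugate_conjugate]⟩

theorem conjIsotropy_of_identityComponent_eq
    (h : identityComponent (MulAction.stabilizer G x) =
      identityComponent (MulAction.stabilizer G y)) : ConjIsotropy ι x y :=
  ⟨1, by rw [conjugate_one, h]⟩

variable {EG : Type*} [NormedAddCommGroup EG] [NormedSpace ℝ EG] [ChartedSpace EG G]
  [MulAction K M] (hres : ∀ (g : G) (x : M), g • x = ι g • x) {α : K → G ≃* G}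
  (hα : IsSmoothConj EG ι α)

include hres hα

theorem map_identityComponent_smul (k : K) (y : M) :
    (identityComponent (MulAction.stabilizer G (k • y))).map ι =
      conjugate k ((identityComponent (MulAction.stabilizer G y)).map ι) := by
  rw [stabilizer_smul_eq_map hres hα.map_apply, identityComponent_map _ (hα.contMDiff k).continuous
    (hα.contMDiff_symm k).continuous, conjugate, Subgroup.map_map, Subgroup.map_map]
  congr 1 with g
  exact hα.map_apply k g

theorem conjIsotropy_smul (k : K) (y : M) : ConjIsotropy ι (k • y) y :=
  ⟨k, map_identityComponent_smul hres hα k y⟩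

omit [IsTopologicalGroup G] in
theorem subgroupDim_stabilizer_smul [FiniteDimensional ℝ EG] (k : K) (y : M) :
    subgroupDim EG (MulAction.stabilizer G (k • y)) =
      subgroupDim EG (MulAction.stabilizer G y) := by
  rw [stabilizer_smul_eq_map hres hα.map_apply]
  exact subgroupDim_map (α k) (hα.contMDiff k) (hα.contMDiff_symm k) _

end ConjIsotropy

section LocRegular

variable {EG : Type*} [NormedAddCommGroup EG] [NormedSpace ℝ EG]
  {G : Type*} [TopologicalSpace G] [ChartedSpace EG G] [Group G]
  {M : Type*} [TopologicalSpace M] [MulAction G M]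

variable (EG G M) in
/-- The points near which the dimension of the isotropy group is constant. Unlike that of
`regularStratum`, this condition is local. -/
def locRegular : Set M :=
  {x | ∀ᶠ y in 𝓝 x, subgroupDim EG (MulAction.stabilizer G y) =
    subgroupDim EG (MulAction.stabilizer G x)}

variable (EG G M) in
theorem regularStratum_subset_locRegular : regularStratum EG G M ⊆ locRegular EG G M := fun x hx ↦
  mem_of_superset (IsOpen.mem_nhds hx rfl : stratum EG G x ∈ 𝓝 x) fun _ hy ↦ Eq.symm hy

theorem mem_regularStratum_of_mem_stratum {x y : M} (hx : x ∈ regularStratum EG G M)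
    (hy : y ∈ stratum EG G x) : y ∈ regularStratum EG G M := by
  have hxy : stratum EG G y = stratum EG G x :=
    Set.ext fun z ↦ ⟨fun hz ↦ Eq.trans hy hz, fun hz ↦ (Eq.symm hy).trans hz⟩
  exact (congrArg IsOpen hxy).mpr hx

theorem smul_mem_locRegular [FiniteDimensional ℝ EG] {K : Type*} [Group K] [MulAction K M]
    [ContinuousConstSMul K M] {ι : G →* K} (hres : ∀ (g : G) (x : M), g • x = ι g • x)
    {α : K → G ≃* G} (hα : IsSmoothConj EG ι α) (k : K) {y : M} (hy : y ∈ locRegular EG G M) :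
    k • y ∈ locRegular EG G M := by
  have ht : Tendsto (fun z : M ↦ k⁻¹ • z) (𝓝 (k • y)) (𝓝 y) :=
    (continuous_const_smul k⁻¹).tendsto' _ _ (inv_smul_smul k y)
  change ∀ᶠ z in 𝓝 (k • y), _
  filter_upwards [ht.eventually hy] with z hz
  rwa [subgroupDim_stabilizer_smul hres hα] at hz ⊢

variable {EM : Type*} [NormedAddCommGroup EM] [NormedSpace ℝ EM] [FiniteDimensional ℝ EM]
  [FiniteDimensional ℝ EG] [LieGroup 𝓘(ℝ, EG) ∞ G] [IsTopologicalGroup G]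
  [ChartedSpace EM M] [IsManifold 𝓘(ℝ, EM) ∞ M] [ContMDiffSMul 𝓘(ℝ, EG) 𝓘(ℝ, EM) ∞ G M]

variable (EG EM)

include EG EM in
theorem identityComponent_stabilizer_eq_of_le {x y : M}
    (hle : MulAction.stabilizer G y ≤ MulAction.stabilizer G x)
    (hdim : subgroupDim EG (MulAction.stabilizer G y) = subgroupDim EG (MulAction.stabilizer G x)) :
    identityComponent (MulAction.stabilizer G y) = identityComponent (MulAction.stabilizer G x) :=
  identityComponent_eq_of_eventually hle (eventually_mem_stabilizer_of_le EG EM hle hdim)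

include EM in
theorem identityComponent_eq_of_tendsto {ι : Type*} {l : Filter ι} [l.NeBot] {f : ι → M} {y : M}
    (hy : y ∈ locRegular EG G M) (hf : Tendsto f l (𝓝 y)) {S : Subgroup G}
    (hS : ∀ᶠ i in l, MulAction.stabilizer G (f i) = S) (hle : S ≤ MulAction.stabilizer G y) :
    identityComponent S = identityComponent (MulAction.stabilizer G y) := by
  obtain ⟨i, rfl, hdim⟩ := (hS.and (hf.eventually hy)).exists
  exact identityComponent_stabilizer_eq_of_le EG EM hle hdim

end LocRegular

section Strata

universe u

variable {EG : Type*} [NormedAddCommGroup EG] [NormedSpace ℝ EG] [FiniteDimensional ℝ EG]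
  {G : Type*} [TopologicalSpace G] [ChartedSpace EG G] [Group G]
  {EK : Type*} [NormedAddCommGroup EK] [NormedSpace ℝ EK]
  {K : Type*} [TopologicalSpace K] [ChartedSpace EK K] [Group K]
  {EM : Type u} [NormedAddCommGroup EM] [NormedSpace ℝ EM] [FiniteDimensional ℝ EM]
  {M : Type*} [TopologicalSpace M] [ChartedSpace EM M] [IsManifold 𝓘(ℝ, EM) ∞ M]
  [MulAction K M] [MulAction G M] {ι : G →* K}
  (hres : ∀ (g : G) (x : M), g • x = ι g • x) {α : K → G ≃* G} (hα : IsSmoothConj EG ι α)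

section Slice

variable {V : Type*} [NormedAddCommGroup V] [NormedSpace ℝ V] [IsTopologicalGroup G]
  {x : M} {ρ : MulAction.stabilizer K x →* (V →L[ℝ] V)} {O : Set V} {σ : V → M}

variable (EM) in
include hres EM in
theorem IsSlice.identityComponent_eq [LieGroup 𝓘(ℝ, EG) ∞ G]
    [ContMDiffSMul 𝓘(ℝ, EG) 𝓘(ℝ, EM) ∞ G M] (hσ : IsSlice ρ O σ)
    {B : LinearMap.BilinForm ℝ V} (hB : IsInvariantInner B ρ) {v w : V} (hv : v ∈ O) (hw : w ∈ O)
    (hmax : ∀ h, B v (ρ h w) ≤ B v w) (hvR : σ v ∈ locRegular EG G M)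
    (hwR : σ w ∈ locRegular EG G M) :
    identityComponent (MulAction.stabilizer G (σ v)) =
      identityComponent (MulAction.stabilizer G (σ w)) := by
  set S := MulAction.stabilizer G (σ v) ⊓ MulAction.stabilizer G (σ w)
  have hS {t : ℝ} (ht : t ∈ Ioo (0 : ℝ) 1) :
      MulAction.stabilizer G (σ ((1 - t) • v + t • w)) = S := by
    rw [stabilizer_eq_comap hres, hσ.stabilizer_segment hB hv hw hmax ht.1 ht.2,
      Subgroup.comap_inf, ← stabilizer_eq_comap hres, ← stabilizer_eq_comap hres]
  have hO {t : ℝ} (ht : t ∈ Ioo (0 : ℝ) 1) : (1 - t) • v + t • w ∈ O :=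
    hσ.convex hv hw (sub_nonneg.2 ht.2.le) ht.1.le (sub_add_cancel 1 t)
  have htend {t₀ : ℝ} {n : V} (hn : n ∈ O) (hγ : (1 - t₀) • v + t₀ • w = n) :
      Tendsto (fun t : ℝ ↦ σ ((1 - t) • v + t • w)) (𝓝[Ioo 0 1] t₀) (𝓝 (σ n)) := by
    have hcont : Continuous fun t : ℝ ↦ (1 - t) • v + t • w := by fun_prop
    exact (hσ.continuousOn n hn).tendsto.comp (tendsto_nhdsWithin_iff.2
      ⟨(hcont.tendsto' t₀ n hγ).mono_left nhdsWithin_le_nhds,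
        eventually_nhdsWithin_of_forall fun t ht ↦ hO ht⟩)
  have hnebot {t₀ : ℝ} (ht₀ : t₀ ∈ Icc (0 : ℝ) 1) : (𝓝[Ioo 0 1] t₀).NeBot := by
    rwa [← mem_closure_iff_nhdsWithin_neBot, closure_Ioo zero_ne_one]
  have := hnebot (left_mem_Icc.2 zero_le_one)
  have := hnebot (right_mem_Icc.2 zero_le_one)
  calc identityComponent (MulAction.stabilizer G (σ v))
      = identityComponent S := (identityComponent_eq_of_tendsto EG EM hvR (htend (t₀ := 0) hv
        (by simp)) (eventually_nhdsWithin_of_forall fun t ht ↦ hS ht) inf_le_left).symm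
    _ = _ := identityComponent_eq_of_tendsto EG EM hwR (htend (t₀ := 1) hw (by simp))
        (eventually_nhdsWithin_of_forall fun t ht ↦ hS ht) inf_le_right

variable (EM) in
include hres hα EM in
theorem IsSlice.conjIsotropy [LieGroup 𝓘(ℝ, EG) ∞ G] [ContMDiffSMul 𝓘(ℝ, EG) 𝓘(ℝ, EM) ∞ G M]
    [IsTopologicalGroup K] [ContinuousConstSMul K M] [CompactSpace (MulAction.stabilizer K x)]
    [FiniteDimensional ℝ V] (hσ : IsSlice ρ O σ) {v w : V} (hv : v ∈ O) (hw : w ∈ O)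
    (hvR : σ v ∈ locRegular EG G M) (hwR : σ w ∈ locRegular EG G M) :
    ConjIsotropy ι (σ v) (σ w) := by
  obtain ⟨B, hB⟩ := exists_isInvariantInner hσ.continuous_rep
  obtain ⟨h, hmax⟩ := exists_forall_apply_le hσ.continuous_rep (B v) w
  have hhw : σ (ρ h w) = (h : K) • σ w := hσ.map_rep h w hw
  have hcomp : identityComponent (MulAction.stabilizer G (σ v)) =
      identityComponent (MulAction.stabilizer G (σ (ρ h w))) :=
    hσ.identityComponent_eq EM hres hB hv (hσ.rep_mem h w hw) hmax hvR
      (hhw ▸ smul_mem_locRegular hres hα h hwR)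
  refine (conjIsotropy_of_identityComponent_eq hcomp).trans ?_
  rw [hhw]
  exact conjIsotropy_smul hres hα h (σ w)

end Slice

variable [ContMDiffSMul 𝓘(ℝ, EK) 𝓘(ℝ, EM) ∞ K M] [FiniteDimensional ℝ EK]
  [LieGroup 𝓘(ℝ, EK) ∞ K] [CompactSpace K] [T2Space M]

variable (EK EM)

include hres in
omit [TopologicalSpace G] in
theorem exists_smooth_reduction (x : M) : ∃ c : M → K, SmoothNear EM EK c x ∧
    ∀ᶠ y in 𝓝 x, MulAction.stabilizer G ((c y)⁻¹ • y) ≤ MulAction.stabilizer G x := by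
  obtain ⟨N, ρ, O, σ, c, hσ, hc, hcover⟩ := exists_isSlice EK EM K x
  refine ⟨c, hc, hcover.mono fun y ⟨n, hn, hy⟩ ↦ ?_⟩
  rw [inv_smul_eq_iff.2 hy.symm, stabilizer_eq_comap hres, stabilizer_eq_comap hres]
  exact Subgroup.comap_mono (hσ.stabilizer_le hn)

include hres hα EK EM

theorem eventually_subgroupDim_stabilizer_le (x : M) : ∀ᶠ y in 𝓝 x,
    subgroupDim EG (MulAction.stabilizer G y) ≤ subgroupDim EG (MulAction.stabilizer G x) := by
  obtain ⟨c, -, hle⟩ := exists_smooth_reduction EK EM hres x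
  filter_upwards [hle] with y hy
  rw [← subgroupDim_stabilizer_smul hres hα (c y)⁻¹, subgroupDim_eq_finrank,
    subgroupDim_eq_finrank]
  exact Submodule.finrank_mono (subgroupLieAlgebra_mono hy)

theorem dense_locRegular : Dense (locRegular EG G M) := by
  refine dense_iff_inter_open.2 fun U hU hne ↦ ?_
  obtain ⟨x, hx, hmin⟩ := WellFounded.has_min
    (InvImage.wf (fun x : M ↦ subgroupDim EG (MulAction.stabilizer G x)) wellFounded_lt) U hne
  refine ⟨x, hx, ?_⟩
  change ∀ᶠ y in 𝓝 x, _
  filter_upwards [hU.mem_nhds hx, eventually_subgroupDim_stabilizer_le EK EM hres hα x]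
    with y hyU hy
  exact le_antisymm hy (not_lt.1 (hmin y hyU))

variable [IsTopologicalGroup G] [LieGroup 𝓘(ℝ, EG) ∞ G] [ContMDiffSMul 𝓘(ℝ, EG) 𝓘(ℝ, EM) ∞ G M]

theorem exists_smooth_conjugation {x : M} (hx : x ∈ locRegular EG G M) :
    ∃ c : M → K, SmoothNear EM EK c x ∧ ∀ᶠ y in 𝓝 x,
      (identityComponent (MulAction.stabilizer G y)).map ι =
        conjugate (c y) ((identityComponent (MulAction.stabilizer G x)).map ι) := by
  obtain ⟨c, hc, hle⟩ := exists_smooth_reduction EK EM hres x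
  refine ⟨c, hc, ?_⟩
  filter_upwards [hle, hx] with y hy hdim
  rw [← subgroupDim_stabilizer_smul hres hα (c y)⁻¹] at hdim
  rw [← identityComponent_stabilizer_eq_of_le EG EM hy hdim,
    ← map_identityComponent_smul hres hα, smul_inv_smul]

theorem eventually_conjIsotropy (x : M) : ∃ W ∈ 𝓝 x, ∀ y ∈ W, ∀ z ∈ W,
    y ∈ locRegular EG G M → z ∈ locRegular EG G M → ConjIsotropy ι y z := by
  have := ContMDiffSMul.continuousSMul (I := 𝓘(ℝ, EK)) (I' := 𝓘(ℝ, EM)) (G := K) (M := M) ∞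
  have := topologicalGroup_of_lieGroup 𝓘(ℝ, EK) ∞ (G := K)
  have := compactSpace_stabilizer K x
  obtain ⟨N, ρ, O, σ, c, hσ, -, hcover⟩ := exists_isSlice EK EM K x
  refine ⟨_, hcover, ?_⟩
  rintro y ⟨v, hv, hy⟩ z ⟨w, hw, hz⟩ hyR hzR
  have hvR : σ v ∈ locRegular EG G M :=
    eq_inv_smul_iff.2 hy ▸ smul_mem_locRegular hres hα (c y)⁻¹ hyR
  have hwR : σ w ∈ locRegular EG G M :=
    eq_inv_smul_iff.2 hz ▸ smul_mem_locRegular hres hα (c z)⁻¹ hzR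
  have hyv : ConjIsotropy ι y (σ v) := by
    simpa only [hy] using conjIsotropy_smul hres hα (c y) (σ v)
  have hzw : ConjIsotropy ι z (σ w) := by
    simpa only [hz] using conjIsotropy_smul hres hα (c z) (σ w)
  exact hyv.trans ((hσ.conjIsotropy EM hres hα hv hw hvR hwR).trans hzw.symm)

theorem conjIsotropy_of_mem_locRegular [ConnectedSpace M] {y z : M}
    (hy : y ∈ locRegular EG G M) (hz : z ∈ locRegular EG G M) : ConjIsotropy ι y z := by
  let P : M → M → Prop := fun x x' ↦ ∃ W ∈ 𝓝 x, ∃ W' ∈ 𝓝 x', ∀ y ∈ W, ∀ z ∈ W',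
    y ∈ locRegular EG G M → z ∈ locRegular EG G M → ConjIsotropy ι y z
  have hsymm : Std.Symm P := ⟨fun x x' ⟨W, hW, W', hW', h⟩ ↦
    ⟨W', hW', W, hW, fun y hy z hz hyR hzR ↦ (h z hz y hy hzR hyR).symm⟩⟩
  have htrans : IsTrans M P := by
    refine ⟨fun x x' x'' ⟨W, hW, W', hW', h⟩ ⟨V, hV, V', hV', h'⟩ ↦
      ⟨W, hW, V', hV', fun y hy z hz hyR hzR ↦ ?_⟩⟩
    obtain ⟨q, hqR, hqW, hqV⟩ :=
      (dense_locRegular EK EM hres hα).inter_nhds_nonempty (inter_mem hW' hV)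
    exact (h y hy q hqW hyR hqR).trans (h' q hqV z hz hqR hzR)
  have hP : P y z := by
    refine PreconnectedSpace.induction₂ P (fun x ↦ ?_) htrans y z
    obtain ⟨W, hW, h⟩ := eventually_conjIsotropy EK EM hres hα x
    filter_upwards [eventually_mem_nhds_iff.2 hW] with x' hx' using ⟨W, hW, W, hx', h⟩
  obtain ⟨W, hW, W', hW', h⟩ := hP
  exact h y (mem_of_mem_nhds hW) z (mem_of_mem_nhds hW') hy hz

end Strata

section Restriction

theorem contMDiffSMul_of_smul_eq {EG EK EM : Type*} [NormedAddCommGroup EG] [NormedSpace ℝ EG]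
    [NormedAddCommGroup EK] [NormedSpace ℝ EK] [NormedAddCommGroup EM] [NormedSpace ℝ EM]
    {G K M : Type*} [TopologicalSpace G] [ChartedSpace EG G] [Group G] [TopologicalSpace K]
    [ChartedSpace EK K] [Group K] [TopologicalSpace M] [ChartedSpace EM M] [MulAction K M]
    [ContMDiffSMul 𝓘(ℝ, EK) 𝓘(ℝ, EM) ∞ K M] [MulAction G M] {ι : G →* K}
    (hι : ContMDiff 𝓘(ℝ, EG) 𝓘(ℝ, EK) ∞ ι) (hres : ∀ (g : G) (x : M), g • x = ι g • x) :
    ContMDiffSMul 𝓘(ℝ, EG) 𝓘(ℝ, EM) ∞ G M := by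
  obtain rfl : ‹MulAction G M› = MulAction.compHom M ι := MulAction.ext (funext₂ hres)
  exact MulAction.contMDiffSMul_compHom hι

end Restriction

end KillingFoliation

open KillingFoliation in
theorem mainTheorem6_general
    {EG : Type*} [NormedAddCommGroup EG] [NormedSpace ℝ EG] [FiniteDimensional ℝ EG]
    {G : Type*} [TopologicalSpace G] [ChartedSpace EG G] [Group G] [LieGroup 𝓘(ℝ, EG) ∞ G]
    [IsTopologicalGroup G] [ConnectedSpace G]
    {EK : Type*} [NormedAddCommGroup EK] [NormedSpace ℝ EK] [FiniteDimensional ℝ EK]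
    {K : Type*} [TopologicalSpace K] [ChartedSpace EK K] [Group K] [LieGroup 𝓘(ℝ, EK) ∞ K]
    [CompactSpace K]
    {EM : Type*} [NormedAddCommGroup EM] [NormedSpace ℝ EM] [FiniteDimensional ℝ EM]
    {M : Type*} [TopologicalSpace M] [ChartedSpace EM M] [IsManifold 𝓘(ℝ, EM) ∞ M]
    [T2Space M] [ConnectedSpace M]
    (ι : G →* K) (hι_smooth : ContMDiff 𝓘(ℝ, EG) 𝓘(ℝ, EK) ∞ ι)
    (hι_inj : Function.Injective ι) (hι_dense : DenseRange ι)
    [MulAction K M] [ContMDiffSMul 𝓘(ℝ, EK) 𝓘(ℝ, EM) ∞ K M]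
    [MulAction G M] (hres : ∀ (g : G) (x : M), g • x = ι g • x)
    (p : M) (hp : p ∈ regularStratum EG G M)
    (L : Subgroup G)
    (hL : L = identityComponent (MulAction.stabilizer G p)) :
    (∀ x ∈ regularStratum EG G M, ∃ k : K,
      (identityComponent (MulAction.stabilizer G x)).map ι =
        conjugate k (L.map ι)) ∧
    (∀ x ∈ regularStratum EG G M, ∃ V : Set M,
      IsOpen V ∧ x ∈ V ∧ V ⊆ regularStratum EG G M ∧
      ∃ f : M → K, ContMDiffOn 𝓘(ℝ, EM) 𝓘(ℝ, EK) ∞ f V ∧ ∀ y ∈ V,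
        (identityComponent (MulAction.stabilizer G y)).map ι =
          conjugate (f y) (L.map ι)) := by
  have := contMDiffSMul_of_smul_eq (EM := EM) hι_smooth hres
  obtain ⟨α, hα⟩ := exists_isSmoothConj hι_smooth hι_inj hι_dense
  have hglobal : ∀ x ∈ regularStratum EG G M, ∃ k : K,
      (identityComponent (MulAction.stabilizer G x)).map ι = conjugate k (L.map ι) := fun x hx ↦
    hL ▸ conjIsotropy_of_mem_locRegular EK EM hres hα
      (regularStratum_subset_locRegular EG G M hx) (regularStratum_subset_locRegular EG G M hp)
  refine ⟨hglobal, fun x hx ↦ ?_⟩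
  obtain ⟨k, hk⟩ := hglobal x hx
  obtain ⟨c, hc, hconj⟩ := exists_smooth_conjugation EK EM hres hα
    (regularStratum_subset_locRegular EG G M hx)
  obtain ⟨V, hV, hVo, hxV⟩ := mem_nhds_iff.1 <|
    hc.mul (smoothNear_const k x) |>.and <| hconj.and <| IsOpen.mem_nhds hx rfl
  refine ⟨V, hVo, hxV, fun y hy ↦ mem_regularStratum_of_mem_stratum hx (hV hy).2.2,
    fun y ↦ c y * k, fun y hy ↦ (hV hy).1.contMDiffWithinAt, fun y hy ↦ ?_⟩
  rw [(hV hy).2.1, hk, conjugate_conjugate]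

theorem mainTheorem6
    -- the connected Lie group `G`
    {EG : Type*} [NormedAddCommGroup EG] [NormedSpace ℝ EG] [FiniteDimensional ℝ EG]
    {G : Type*} [TopologicalSpace G] [ChartedSpace EG G] [Group G] [LieGroup 𝓘(ℝ, EG) ∞ G]
    [IsTopologicalGroup G] [T2Space G] [ConnectedSpace G]
    -- the compact Lie group `K`
    {EK : Type*} [NormedAddCommGroup EK] [NormedSpace ℝ EK] [FiniteDimensional ℝ EK]
    {K : Type*} [TopologicalSpace K] [ChartedSpace EK K] [Group K] [LieGroup 𝓘(ℝ, EK) ∞ K]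
    [T2Space K] [CompactSpace K]
    -- the manifold `M`
    {EM : Type*} [NormedAddCommGroup EM] [NormedSpace ℝ EM] [FiniteDimensional ℝ EM]
    {M : Type*} [TopologicalSpace M] [ChartedSpace EM M] [IsManifold 𝓘(ℝ, EM) ∞ M]
    [T2Space M] [SecondCountableTopology M] [ConnectedSpace M]
    -- `G` is a dense Lie subgroup of `K`, with inclusion `ι`
    (ι : G →* K) (hι_smooth : ContMDiff 𝓘(ℝ, EG) 𝓘(ℝ, EK) ∞ ι)
    (hι_inj : Function.Injective ι) (hι_dense : DenseRange ι)
    -- the smooth action of `K` on `M` and its restriction to `G`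
    [MulAction K M] [ContMDiffSMul 𝓘(ℝ, EK) 𝓘(ℝ, EM) ∞ K M]
    [MulAction G M] (hres : ∀ (g : G) (x : M), g • x = ι g • x)
    -- the base point
    (p : M) (hp : p ∈ KillingFoliation.regularStratum EG G M)
    (L : Subgroup G)
    (hL : L = KillingFoliation.identityComponent (MulAction.stabilizer G p)) :
    (∀ x ∈ KillingFoliation.regularStratum EG G M, ∃ k : K,
      (KillingFoliation.identityComponent (MulAction.stabilizer G x)).map ι =
        KillingFoliation.conjugate k (L.map ι)) ∧
    (∀ x ∈ KillingFoliation.regularStratum EG G M, ∃ V : Set M,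
      IsOpen V ∧ x ∈ V ∧ V ⊆ KillingFoliation.regularStratum EG G M ∧
      ∃ f : M → K, ContMDiffOn 𝓘(ℝ, EM) 𝓘(ℝ, EK) ∞ f V ∧ ∀ y ∈ V,
        (KillingFoliation.identityComponent (MulAction.stabilizer G y)).map ι =
          KillingFoliation.conjugate (f y) (L.map ι)) :=
  mainTheorem6_general ι hι_smooth hι_inj hι_dense hres p hp L hL
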